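/- Let $N\ge 2$, let $U\subseteq\mathbb R^N$ be open (with the flat metric and coordinates $x^1,\dots,x^N$), and let "smooth" mean $C^\infty$. For functions $A_1,\dots,A_N$ let $\{A_1,\dots,A_N\}_{NB}=\epsilon^{i_1\cdots i_N}\,\partial_{i_1}A_1\cdots\partial_{i_N}A_N$ be the Nambu bracket (the Jacobian determinant). A vector field $v$ is called a Nambu non-equilibrium thermodynamics (NNET) on an open set $V$, with Hamiltonians $H_1,\dots,H_{N-1}$ and entropy $S$, if $H_1,\dots,H_{N-1},S$ are smooth on $V$ and $$v^\mu=\{x^\mu,H_1,\dots,H_{N-1}\}_{NB}+\partial_\mu S\qquad(\mu=1,\dots,N)\quad\text{on }V.$$ 1. (Local existence.) Let $v$ be a smooth vector field on $U$, defining the autonomous system $\dot x=v(x)$. Then each point $x_0\in U$ has an open neighbourhood $V\subseteq U$ on which $v$ is an NNET for some Hamiltonians $H_1,\dots,H_{N-1}$ and some entropy $S$. 2. (Given splitting.) Let $v=v^{(1)}+v^{(2)}$ on $U$, where $v^{(1)},v^{(2)}$ are smooth, $v^{(1)}$ is incompressible, $\partial_\mu v^{(1)\mu}=0$, and $v^{(2)}$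 is a compressible flow satisfying $\partial_\mu v^{(2)}_\nu-\partial_\nu v^{(2)}_\mu=0$. Let $x_0\in U$ and assume that $N=2$ or $v^{(1)}(x_0)\neq 0$. Then there are an open neighbourhood $V\subseteq U$ of $x_0$ and smooth $H_1,\dots,H_{N-1},S$ on $V$ such that $$v^{(1)\mu}=\{x^\mu,H_1,\dots,H_{N-1}\}_{NB},\qquad v^{(2)\mu}=\partial_\mu S\quad\text{on }V;$$ in particular $v$ is an NNET on $V$ with these data. 3. (Reduction of non-linear response.) Let $H_1,\dots,H_{N-1}$ and $S$ be smooth on $U$, let $L^{a_1\cdots a_{k+2}}(x)$, $k=0,1,2,\dots$, be completely symmetric transport coefficients, and suppose that for all $x\in U$ and all $j$ the series $$w^j(x)=\sum_{k=0}^{\infty}\ \sum_{a_1,\dots,a_{k+1}=1}^{N}L^{a_1\cdots a_{k+1}j}(x)\,\partial_{a_1}S(x)\cdots\partial_{a_{k+1}}S(x)$$ converges (unconditionally, in $k$) and that $w$ is smooth on $U$. Consider the system $\dot x=v(x)$ with $v^j=\{x^j,H_1,\dots,H_{N-1}\}_{NB}+w^j$. Then each $x_0\in U$ has an open neighbourhood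 $V\subseteq U$ on which there are Hamiltonians $H'_1,\dots,H'_{N-1}$, Hamiltonians $H^C_1,\dots,H^C_{N-1}$ and a single entropy $S^C$, all smooth, such that on $V$ $$w^j=\{x^j,H'_1,\dots,H'_{N-1}\}_{NB}+\partial_jS^C,\qquad v^j=\{x^j,H^C_1,\dots,H^C_{N-1}\}_{NB}+\partial_jS^C .$$ -/

import Mathlib

open scoped ContDiff

noncomputable section

namespace NNET

/-- Flat Euclidean space of dimension `N`, with coordinates `x 0, …, x (N - 1)`. -/
abbrev Space (N : ℕ) : Type := EuclideanSpace ℝ (Fin N)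

/-- The partial derivative `∂f/∂x^i` at `x`. -/
def partialDeriv {N : ℕ} (i : Fin N) (f : Space N → ℝ) (x : Space N) : ℝ :=
  fderiv ℝ f x (EuclideanSpace.single i 1)

/-- The Nambu bracket `{A_1, …, A_N} = ε^{i_1 … i_N} ∂_{i_1} A_1 ⋯ ∂_{i_N} A_N`,
that is, the Jacobian determinant of `(A_1, …, A_N)`. -/
def nambuBracket {N : ℕ} (A : Fin N → Space N → ℝ) (x : Space N) : ℝ :=
  ∑ σ : Equiv.Perm (Fin N),
    ((Equiv.Perm.sign σ : ℤ) : ℝ) * ∏ k : Fin N, partialDeriv (σ k) (A k) x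

/-- The component `{x^μ, H_1, …, H_{N-1}}` of the Nambu flow in dimension `N = n + 1`
with Hamiltonians `H 0, …, H (n - 1)`. -/
def nambuFlow {n : ℕ} (H : Fin n → Space (n + 1) → ℝ) (x : Space (n + 1))
    (μ : Fin (n + 1)) : ℝ :=
  nambuBracket (Fin.cons (fun y : Space (n + 1) => y μ) H) x

/-- Incompressible flow: `∑ μ, ∂_μ v^μ = 0` on `U`. -/
def IsIncompressibleOn {N : ℕ} (U : Set (Space N)) (v : Space N → Space N) : Prop :=
  ∀ x ∈ U, ∑ μ : Fin N, partialDeriv μ (fun y => v y μ) x = 0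

/-- Compressible (dissipative) flow: `∂_μ v_ν - ∂_ν v_μ = 0` on `U`. -/
def IsCurlFreeOn {N : ℕ} (U : Set (Space N)) (v : Space N → Space N) : Prop :=
  ∀ x ∈ U, ∀ μ ν : Fin N,
    partialDeriv μ (fun y => v y ν) x - partialDeriv ν (fun y => v y μ) x = 0

/-- On `V`, the Hamiltonians `H` and the entropy `S` are smooth and present the system
`ẋ = v(x)` as a Nambu non-equilibrium thermodynamics:
`v^μ = {x^μ, H_1, …, H_{N-1}} + ∂_μ S`. -/
structure IsNNETOn {n : ℕ} (V : Set (Space (n + 1))) (v : Space (n + 1) → Space (n + 1))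
    (H : Fin n → Space (n + 1) → ℝ) (S : Space (n + 1) → ℝ) : Prop where
  smooth_hamiltonian : ∀ a, ContDiffOn ℝ ∞ (H a) V
  smooth_entropy : ContDiffOn ℝ ∞ S V
  eq_flow : ∀ x ∈ V, ∀ μ, v x μ = nambuFlow H x μ + partialDeriv μ S x

/-- The response current of order `k + 1` in the affinity forces `A_a = ∂_a S`, with component
`∑ L^{a_1 … a_{k+1} j} A_{a_1} ⋯ A_{a_{k+1}}` along `x^j`. -/
def responseTerm {N : ℕ} (k : ℕ) (L : (Fin (k + 2) → Fin N) → Space N → ℝ)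
    (S : Space N → ℝ) (x : Space N) (j : Fin N) : ℝ :=
  ∑ a : Fin (k + 1) → Fin N,
    L (Fin.snoc (α := fun _ => Fin N) a j) x * ∏ i : Fin (k + 1), partialDeriv (a i) S x

/-- On `U`, the smooth vector field `w` is the non-linear response to the smooth entropy `S`
with completely symmetric transport coefficients `L k` of order `k + 2`, `k = 0, 1, 2, …`:
the series of the response currents converges to `w` at each point. -/
structure IsNonlinearResponseOn {N : ℕ} (U : Set (Space N))
    (L : (k : ℕ) → (Fin (k + 2) → Fin N) → Space N → ℝ) (S : Space N → ℝ)
    (w : Space N → Space N) : Prop where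
  symmetric : ∀ (k : ℕ) (σ : Equiv.Perm (Fin (k + 2))) (a : Fin (k + 2) → Fin N),
    ∀ x ∈ U, L k (fun i => a (σ i)) x = L k a x
  smooth_entropy : ContDiffOn ℝ ∞ S U
  smooth_response : ContDiffOn ℝ ∞ w U
  hasSum : ∀ x ∈ U, ∀ j, HasSum (fun k => responseTerm k (L k) S x j) (w x j)

end NNET

end

/-!
The statement is local, so all data are replaced by globally smooth functions with the same germs at
`x₀` (`ContDiffOn.exists_contDiff_eventuallyEq`), and identities are asserted for all `x` near `x₀`.

An incompressible field `v` with `v x₀ ≠ 0` is a Nambu flow (`NNET.exists_nambuFlow_of_ne_zero`).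
In coordinates `g` that straighten `v` to `∂_0`, the functions `g 1, …, g n` are first integrals,
and Cramer's rule shows that their Nambu flow is `ρ v`, where `ρ` is the Jacobian determinant of
`g`. Nambu flows are incompressible, so `ρ` is constant along `v`, hence a function of
`g 1, …, g n`; replacing `g 1` by a primitive of `1 / ρ` with respect to that coordinate turns the
density into `1`. The straightening needs a flow that is smooth in time and initial point. It comes
from the inverse function theorem on the Banach space of continuous curves, applied to the integral
equation `γ = x + ε ∫ v(γ)` at `ε = 0`; composition with a smooth map is a smooth operator on that
space (`ContDiff.contDiff_postcomp`, `exists_smooth_curve_family`).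

A general field `v` is made incompressible by the subtraction of `∇S` with `ΔS = div v`. The Poisson
equation is solved near `x₀` by Fourier transform: instead of a cut-off `F` of the right-hand side
one takes the second difference `F - 2 F(· - b) + F(· - 2b)`, which agrees with `F` near `x₀` for
long `b`, and whose Fourier transform vanishes to second order where the symbol of the Laplacian
does (`ContDiff.exists_laplacian_eventuallyEq`). A linear function added to `S` makes `v - ∇S`
non-zero at `x₀`, simultaneously for two fields `v` if need be. Since Nambu flows are
incompressible, `w` and `nambuFlow H + w` have the same divergence, so one `S` serves both
(`NNET.exists_common_entropy`).

For a given splitting the entropy comes from the Poincaré lemma. In the plane, where the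
incompressible part may vanish, the Poincaré lemma for the rotated field gives the Hamiltonian.
-/

noncomputable section

universe u

open Filter Topology Set MeasureTheory

/-! ### Germs of smooth maps -/

/-- A map that is smooth near a point has the germ of a globally smooth map: multiply it by a bump
function. -/
theorem ContDiffOn.exists_contDiff_eventuallyEq {E F : Type*} [NormedAddCommGroup E]
    [NormedSpace ℝ E] [HasContDiffBump E] [NormedAddCommGroup F] [NormedSpace ℝ F]
    {f : E → F} {U : Set E} {x₀ : E} (hf : ContDiffOn ℝ ∞ f U) (hU : U ∈ 𝓝 x₀) :
    ∃ g : E → F, ContDiff ℝ ∞ g ∧ g =ᶠ[𝓝 x₀] f := by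
  obtain ⟨r, hr, hrU⟩ := Metric.mem_nhds_iff.1 hU
  let χ : ContDiffBump x₀ := ⟨r / 4, r / 2, by positivity, by linarith⟩
  refine ⟨fun x => χ x • f x, ?_, ?_⟩
  · rw [contDiff_iff_contDiffAt]
    intro x
    by_cases hx : x ∈ Metric.ball x₀ r
    · exact χ.contDiff.contDiffAt.smul
        ((hf.mono hrU).contDiffAt (Metric.isOpen_ball.mem_nhds hx))
    · have hx' : x ∉ tsupport χ := by
        rw [χ.tsupport_eq]
        intro h
        have h1 : Dist.dist x x₀ ≤ r / 2 := h
        exact hx (by rw [Metric.mem_ball]; linarith)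
      have h0 : (fun x => χ x • f x) =ᶠ[𝓝 x] fun _ => 0 := by
        filter_upwards [notMem_tsupport_iff_eventuallyEq.1 hx'] with y hy
        simp [hy]
      exact (contDiffAt_const (c := (0 : F))).congr_of_eventuallyEq h0
  · filter_upwards [χ.eventuallyEq_one] with x hx
    simp [hx]

/-- The inverse function theorem for a smooth map between Banach spaces: the local inverse is smooth
on a neighbourhood. -/
theorem ContDiff.exists_smooth_local_inverse {E F : Type*} [NormedAddCommGroup E]
    [NormedSpace ℝ E] [CompleteSpace E] [NormedAddCommGroup F] [NormedSpace ℝ F]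
    {f : E → F} (hf : ContDiff ℝ ∞ f) {a : E} {f' : E ≃L[ℝ] F}
    (hf' : HasFDerivAt f (f' : E →L[ℝ] F) a) :
    ∃ g : F → E, g (f a) = a ∧ (∀ᶠ y in 𝓝 (f a), ContDiffAt ℝ ∞ g y ∧ f (g y) = y) ∧
      ∀ᶠ x in 𝓝 a, g (f x) = x := by
  have h0 : ContDiffAt ℝ ∞ f a := hf.contDiffAt
  have hn : (∞ : WithTop ℕ∞) ≠ 0 := by simp
  let e := h0.toOpenPartialHomeomorph f hf' hn
  have hsrc : a ∈ e.source := h0.mem_toOpenPartialHomeomorph_source hf' hn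
  have he : (e : E → F) = f := h0.toOpenPartialHomeomorph_coe hf' hn
  have htgt : f a ∈ e.target := h0.image_mem_toOpenPartialHomeomorph_target hf' hn
  have hea : e.symm (f a) = a := by
    have := e.left_inv hsrc
    rwa [he] at this
  refine ⟨e.symm, hea, ?_, ?_⟩
  · have hcont : ContinuousAt (fun y => fderiv ℝ f (e.symm y)) (f a) := by
      refine ContinuousAt.comp (g := fderiv ℝ f) ?_ (e.continuousAt_symm htgt)
      exact (hf.continuous_fderiv (by simp)).continuousAt
    have hinv : ∀ᶠ y in 𝓝 (f a),
        fderiv ℝ f (e.symm y) ∈ range ContinuousLinearEquiv.toContinuousLinearMap := by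
      apply hcont
      change _ ∈ 𝓝 (fderiv ℝ f (e.symm (f a)))
      rw [hea, hf'.fderiv]
      exact f'.nhds
    filter_upwards [hinv, e.open_target.mem_nhds htgt] with y ⟨A, hA⟩ hy
    have hD : HasFDerivAt e (A : E →L[ℝ] F) (e.symm y) := by
      rw [he, hA]
      exact (hf.differentiable (by simp) _).hasFDerivAt
    refine ⟨e.contDiffAt_symm hy hD (by rw [he]; exact hf.contDiffAt), ?_⟩
    have := e.right_inv hy
    rwa [he] at this
  · filter_upwards [e.open_source.mem_nhds hsrc] with x hx
    have := e.left_inv hx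
    rwa [he] at this

/-! ### Composition and integration on spaces of continuous curves -/

section Composition

variable {K : Type*} [TopologicalSpace K] [CompactSpace K]

/-- Pointwise application of a continuous family of linear maps to a continuous family of vectors,
as a continuous bilinear map. -/
def ContinuousMap.applyCLM (K : Type*) [TopologicalSpace K] [CompactSpace K] (E F : Type*)
    [NormedAddCommGroup E] [NormedSpace ℝ E] [NormedAddCommGroup F] [NormedSpace ℝ F] :
    C(K, E →L[ℝ] F) →L[ℝ] C(K, E) →L[ℝ] C(K, F) :=
  LinearMap.mkContinuous₂
    (LinearMap.mk₂ ℝ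
      (fun (A : C(K, E →L[ℝ] F)) (γ : C(K, E)) =>
        (⟨fun t => A t (γ t), A.continuous.clm_apply γ.continuous⟩ : C(K, F)))
      (fun _ _ _ => by ext; simp) (fun _ _ _ => by ext; simp)
      (fun _ _ _ => by ext; simp) (fun _ _ _ => by ext; simp)) 1 (by
        intro A γ
        rw [ContinuousMap.norm_le _ (by positivity)]
        intro t
        rw [one_mul]
        exact (A t).le_of_opNorm_le_of_le (A.norm_coe_le_norm t) (γ.norm_coe_le_norm t))

/-- The derivative of `γ ↦ f ∘ γ` on a space of continuous maps. The mean value inequality gives the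
pointwise estimate; its uniformity over `K` is the continuity of `γ ↦ f' ∘ γ`. -/
theorem ContinuousMap.hasFDerivAt_comp {E F : Type*}
    [NormedAddCommGroup E] [NormedSpace ℝ E] [NormedAddCommGroup F] [NormedSpace ℝ F]
    (f : C(E, F)) (f' : C(E, E →L[ℝ] F)) (hf : ∀ x, HasFDerivAt f (f' x) x) (γ : C(K, E)) :
    HasFDerivAt (fun γ : C(K, E) => f.comp γ) (ContinuousMap.applyCLM K E F (f'.comp γ)) γ := by
  rw [hasFDerivAt_iff_isLittleO_nhds_zero, Asymptotics.isLittleO_iff]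
  intro c hc
  have hcont : ContinuousAt (fun γ : C(K, E) => f'.comp γ) γ :=
    (ContinuousMap.continuous_postcomp f').continuousAt
  obtain ⟨r, hr, hrc⟩ := (Metric.continuousAt_iff (α := C(K, E))
    (β := C(K, E →L[ℝ] F)) (f := fun γ => f'.comp γ)).1 hcont c hc
  filter_upwards [Metric.ball_mem_nhds (0 : C(K, E)) hr] with δ hδ
  rw [mem_ball_zero_iff] at hδ
  rw [ContinuousMap.norm_le _ (by positivity)]
  intro t
  have hδt : ‖δ t‖ ≤ ‖δ‖ := δ.norm_coe_le_norm t
  have key : ‖f (γ t + δ t) - f (γ t) - f' (γ t) ((γ t + δ t) - γ t)‖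
      ≤ c * ‖(γ t + δ t) - γ t‖ := by
    refine (convex_ball (γ t) r).norm_image_sub_le_of_norm_hasFDerivWithin_le'
      (f' := f') (fun x _ => (hf x).hasFDerivWithinAt) ?_ (Metric.mem_ball_self hr) ?_
    · intro z hz
      -- a constant perturbation of `γ` moves `γ t` to an arbitrary nearby point `z`
      have h1 : dist (γ + ContinuousMap.const K (z - γ t)) γ < r := by
        rw [dist_eq_norm, add_sub_cancel_left]
        refine lt_of_le_of_lt ((ContinuousMap.norm_le _ (norm_nonneg (z - γ t))).2
          (fun _ => le_rfl)) ?_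
        rwa [← dist_eq_norm]
      have h2 := (ContinuousMap.dist_apply_le_dist
        (f := f'.comp (γ + ContinuousMap.const K (z - γ t))) (g := f'.comp γ) t).trans (hrc h1).le
      simpa [dist_eq_norm] using h2
    · rw [Metric.mem_ball, dist_eq_norm, add_sub_cancel_left]
      exact lt_of_le_of_lt hδt hδ
  rw [add_sub_cancel_left] at key
  calc _ = ‖f (γ t + δ t) - f (γ t) - f' (γ t) (δ t)‖ := rfl
    _ ≤ c * ‖δ t‖ := key
    _ ≤ c * ‖δ‖ := by gcongr

/-- Composition with a smooth map is a smooth operator on spaces of continuous maps. -/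
theorem ContDiff.contDiff_postcomp {E F : Type u}
    [NormedAddCommGroup E] [NormedSpace ℝ E] [NormedAddCommGroup F] [NormedSpace ℝ F]
    {f : E → F} (hf : ContDiff ℝ ∞ f) :
    ContDiff ℝ ∞ (fun γ : C(K, E) => (⟨f, hf.continuous⟩ : C(E, F)).comp γ) := by
  rw [contDiff_infty]
  intro n
  induction n generalizing F with
  | zero =>
    exact contDiff_zero.2 (ContinuousMap.continuous_postcomp _)
  | succ n ih =>
    have hf' : ContDiff ℝ ∞ (fderiv ℝ f) := (contDiff_infty_iff_fderiv.1 hf).2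
    refine contDiff_succ_iff_hasFDerivAt.2 ⟨_, ?_, fun γ => ContinuousMap.hasFDerivAt_comp
      ⟨f, hf.continuous⟩ ⟨fderiv ℝ f, hf'.continuous⟩
      (fun x => (hf.differentiable (by simp) x).hasFDerivAt) γ⟩
    exact (ContinuousMap.applyCLM K E F).contDiff.comp (ih hf')

end Composition

/-- The parameter interval `[-1, 1]` of the curves. -/
abbrev CurveInterval : Type := Icc (-1 : ℝ) 1

/-- The extension of a curve on `[-1, 1]` to the line, constant beyond the end points. -/
def curveExtend {E : Type*} [TopologicalSpace E] (γ : C(CurveInterval, E)) (t : ℝ) : E :=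
  IccExtend (by norm_num : (-1 : ℝ) ≤ 1) γ t

theorem continuous_curveExtend {E : Type*} [TopologicalSpace E] (γ : C(CurveInterval, E)) :
    Continuous (curveExtend γ) :=
  γ.continuous.Icc_extend'

theorem curveExtend_apply {E : Type*} [TopologicalSpace E] (γ : C(CurveInterval, E))
    (t : CurveInterval) : curveExtend γ t = γ t :=
  IccExtend_val _ _ t

theorem curveExtend_of_mem {E : Type*} [TopologicalSpace E] (γ : C(CurveInterval, E))
    {t : ℝ} (ht : t ∈ Icc (-1 : ℝ) 1) : curveExtend γ t = γ ⟨t, ht⟩ :=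
  curveExtend_apply γ ⟨t, ht⟩

theorem norm_curveExtend_le {E : Type*} [NormedAddCommGroup E] (γ : C(CurveInterval, E)) (t : ℝ) :
    ‖curveExtend γ t‖ ≤ ‖γ‖ :=
  γ.norm_coe_le_norm _

section Integration

variable {E : Type*} [NormedAddCommGroup E] [NormedSpace ℝ E]

/-- The operator `γ ↦ (t ↦ ∫_0^t γ)` on continuous curves. -/
def curveIntegralCLM (E : Type*) [NormedAddCommGroup E] [NormedSpace ℝ E] :
    C(CurveInterval, E) →L[ℝ] C(CurveInterval, E) :=
  LinearMap.mkContinuous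
    { toFun := fun γ => ⟨fun t => ∫ s in (0 : ℝ)..t, curveExtend γ s, by
          have h := intervalIntegral.continuous_primitive (μ := volume)
            (fun a b => (continuous_curveExtend γ).intervalIntegrable a b) 0
          exact h.comp continuous_subtype_val⟩
      map_add' := fun γ δ => by
        ext t
        exact intervalIntegral.integral_add ((continuous_curveExtend γ).intervalIntegrable _ _)
          ((continuous_curveExtend δ).intervalIntegrable _ _)
      map_smul' := fun c γ => by
        ext t
        exact intervalIntegral.integral_smul c _ } 1 (by
    intro γ
    rw [ContinuousMap.norm_le _ (by positivity)]
    intro t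
    have h := intervalIntegral.norm_integral_le_of_norm_le_const (a := 0) (b := (t : ℝ))
      (f := curveExtend γ) (C := ‖γ‖) (fun s _ => norm_curveExtend_le γ s)
    have ht : |(t : ℝ) - 0| ≤ 1 := by
      rw [sub_zero, abs_le]; exact t.2
    calc _ ≤ ‖γ‖ * |(t : ℝ) - 0| := h
      _ ≤ ‖γ‖ * 1 := by gcongr
      _ = 1 * ‖γ‖ := by ring)

theorem curveIntegralCLM_apply (γ : C(CurveInterval, E)) (t : CurveInterval) :
    curveIntegralCLM E γ t = ∫ s in (0 : ℝ)..t, curveExtend γ s := rfl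

end Integration

/-! ### Smooth primitives along a direction -/

/-- A smooth function has a smooth primitive in the direction of a vector `e`. With `ℓ e = 1`, the
primitive vanishing on the hyperplane `ℓ = 0` is `ℓ y * ∫_0^1 f (y - (1 - s) ℓ(y) e) ds`; its
smoothness is that of the composition operator, since the segments depend linearly on `y`. -/
theorem ContDiff.exists_smooth_primitive {E : Type} [NormedAddCommGroup E] [NormedSpace ℝ E]
    {f : E → ℝ} (hf : ContDiff ℝ ∞ f) (ℓ : E →L[ℝ] ℝ) {e : E} (he : ℓ e = 1) :
    ∃ h : E → ℝ, ContDiff ℝ ∞ h ∧ ∀ y, HasDerivAt (fun t : ℝ => h (y + t • e)) (f y) 0 := by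
  let F : C(E, ℝ) := ⟨f, hf.continuous⟩
  let A : E →L[ℝ] C(CurveInterval, E) := LinearMap.mkContinuous
    { toFun := fun y => (⟨fun s => y - ((1 - (s : ℝ)) * ℓ y) • e, by fun_prop⟩ :
        C(CurveInterval, E))
      map_add' := fun y z => by ext s; simp; module
      map_smul' := fun c y => by ext s; simp; module } (1 + 2 * ‖ℓ‖ * ‖e‖) (by
    intro y
    rw [ContinuousMap.norm_le _ (by positivity)]
    intro s
    have hs : |1 - (s : ℝ)| ≤ 2 := by
      rw [abs_le]; constructor <;> linarith [s.2.1, s.2.2]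
    calc ‖y - ((1 - (s : ℝ)) * ℓ y) • e‖ ≤ ‖y‖ + ‖((1 - (s : ℝ)) * ℓ y) • e‖ := norm_sub_le _ _
      _ = ‖y‖ + |1 - (s : ℝ)| * ‖ℓ y‖ * ‖e‖ := by rw [norm_smul, norm_mul, Real.norm_eq_abs]
      _ ≤ ‖y‖ + 2 * (‖ℓ‖ * ‖y‖) * ‖e‖ := by gcongr; exact ℓ.le_opNorm y
      _ = (1 + 2 * ‖ℓ‖ * ‖e‖) * ‖y‖ := by ring)
  let one : CurveInterval := ⟨1, by norm_num⟩
  let h : E → ℝ := fun y => ℓ y * curveIntegralCLM ℝ (F.comp (A y)) one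
  have hsm : ContDiff ℝ ∞ h := by
    refine ℓ.contDiff.mul ?_
    exact (ContinuousMap.evalCLM ℝ one : C(CurveInterval, ℝ) →L[ℝ] ℝ).contDiff.comp
      ((curveIntegralCLM ℝ).contDiff.comp (hf.contDiff_postcomp.comp A.contDiff))
  have hval : ∀ y, h y = ∫ u in (0 : ℝ)..ℓ y, f (y - ℓ y • e + u • e) := by
    intro y
    have h1 : curveIntegralCLM ℝ (F.comp (A y)) one
        = ∫ s in (0 : ℝ)..1, f (y - ℓ y • e + (ℓ y * s) • e) := by
      rw [curveIntegralCLM_apply]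
      refine intervalIntegral.integral_congr fun s hs => ?_
      rw [uIcc_of_le (by norm_num)] at hs
      rw [curveExtend_of_mem _ ⟨by linarith [hs.1], hs.2⟩]
      change f (y - ((1 - s) * ℓ y) • e) = _
      congr 1
      module
    have h2 := intervalIntegral.mul_integral_comp_mul_left (a := 0) (b := 1)
      (f := fun u => f (y - ℓ y • e + u • e)) (ℓ y)
    simp only [mul_zero, mul_one] at h2
    rw [← h2]
    change ℓ y * _ = _
    rw [h1]
  refine ⟨h, hsm, fun y => ?_⟩
  have hfun : (fun t : ℝ => h (y + t • e))
      = fun t : ℝ => ∫ u in (0 : ℝ)..(ℓ y + t), f (y - ℓ y • e + u • e) := by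
    ext t
    rw [hval]
    have : ℓ (y + t • e) = ℓ y + t := by simp [he]
    rw [this]
    congr 1
    ext u
    congr 1
    module
  rw [hfun]
  have hc : Continuous fun u : ℝ => f (y - ℓ y • e + u • e) := by
    have := hf.continuous; fun_prop
  have h3 : HasDerivAt (fun T : ℝ => ∫ u in (0 : ℝ)..T, f (y - ℓ y • e + u • e))
      (f (y - ℓ y • e + ℓ y • e)) (ℓ y + 0) := by
    rw [add_zero]
    exact hc.deriv_integral _ 0 (ℓ y) ▸
      (intervalIntegral.differentiable_integral_of_continuous hc (a := 0) (ℓ y)).hasDerivAt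
  rw [sub_add_cancel] at h3
  exact h3.comp_const_add (ℓ y) 0

/-! ### Local flows of smooth vector fields -/

section Flow

variable {E : Type u} [NormedAddCommGroup E] [NormedSpace ℝ E]

/-- The constant curves, as a continuous linear map. -/
def constCurveCLM (E : Type*) [NormedAddCommGroup E] [NormedSpace ℝ E] :
    E →L[ℝ] C(CurveInterval, E) :=
  LinearMap.mkContinuous
    { toFun := fun x => ContinuousMap.const _ x
      map_add' := fun _ _ => rfl
      map_smul' := fun _ _ => rfl } 1 (fun x => by
    rw [ContinuousMap.norm_le _ (by positivity), one_mul]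
    exact fun _ => le_rfl)

@[simp]
theorem constCurveCLM_apply (x : E) (t : CurveInterval) : constCurveCLM E x t = x := rfl

/-- The defect of a curve `γ` as a solution of `γ' = ε v(γ)`, `γ 0 = x`, in integrated form. -/
def flowDefect (v : C(E, E)) (p : (ℝ × E) × C(CurveInterval, E)) : C(CurveInterval, E) :=
  p.2 - constCurveCLM E p.1.2 - p.1.1 • curveIntegralCLM E (v.comp p.2)

theorem flowDefect_eq_zero_iff {v : C(E, E)} {p : (ℝ × E) × C(CurveInterval, E)} :
    flowDefect v p = 0 ↔
      ∀ t : CurveInterval, p.2 t = p.1.2 + p.1.1 • ∫ s in (0 : ℝ)..t, v (curveExtend p.2 s) := by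
  rw [ContinuousMap.ext_iff]
  refine forall_congr' fun t => ?_
  have h : flowDefect v p t
      = p.2 t - p.1.2 - p.1.1 • ∫ s in (0 : ℝ)..t, v (curveExtend p.2 s) := rfl
  rw [h, ContinuousMap.zero_apply, sub_sub, sub_eq_zero]

/-- The parametrisation of `[-1, 1]` scaled by a factor `t ∈ [-1, 1]`. -/
def scaleInterval (t : CurveInterval) : C(CurveInterval, CurveInterval) :=
  ⟨fun s => ⟨t * s, by
    have h : |(t : ℝ) * s| ≤ 1 := by
      rw [abs_mul]
      exact mul_le_one₀ (abs_le.2 t.2) (abs_nonneg _) (abs_le.2 s.2)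
    exact abs_le.1 h⟩, by fun_prop⟩

/-- A solution for the time scale `ε` restricts to a solution for the time scale `ε t`. -/
theorem flowDefect_comp_scaleInterval {v : C(E, E)} {ε : ℝ} {x : E} {γ : C(CurveInterval, E)}
    (h : flowDefect v ((ε, x), γ) = 0) (t : CurveInterval) :
    flowDefect v ((ε * t, x), γ.comp (scaleInterval t)) = 0 := by
  rw [flowDefect_eq_zero_iff] at h ⊢
  intro s
  have h1 := h (scaleInterval t s)
  change γ (scaleInterval t s) = _
  rw [h1]
  change x + ε • (∫ r in (0 : ℝ)..(t * s), v (curveExtend γ r)) = x + (ε * t) • _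
  congr 1
  rw [mul_smul]
  congr 1
  have h2 := intervalIntegral.smul_integral_comp_mul_left (a := 0) (b := s)
    (f := fun r => v (curveExtend γ r)) (t : ℝ)
  rw [mul_zero] at h2
  rw [← h2]
  congr 1
  refine intervalIntegral.integral_congr fun r hr => ?_
  have hr' : r ∈ Icc (-1 : ℝ) 1 :=
    (uIcc_subset_Icc (by norm_num) s.2) hr
  change v (curveExtend γ (t * r)) = v (curveExtend (γ.comp (scaleInterval t)) r)
  rw [curveExtend_of_mem _ hr', ContinuousMap.comp_apply]
  congr 1
  exact curveExtend_of_mem _ (scaleInterval t ⟨r, hr'⟩).2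

theorem contDiff_flowDefect {v : E → E} (hv : ContDiff ℝ ∞ v) :
    ContDiff ℝ ∞ (flowDefect (⟨v, hv.continuous⟩ : C(E, E))) := by
  unfold flowDefect
  refine (contDiff_snd.sub ((constCurveCLM E).contDiff.comp (contDiff_snd.comp contDiff_fst))).sub
    ((contDiff_fst.comp contDiff_fst).smul ?_)
  exact (curveIntegralCLM E).contDiff.comp (hv.contDiff_postcomp.comp contDiff_snd)

/-- At time scale `0` the integral equation `γ = x + ε ∫ v(γ)` is trivially solvable for `γ`, so the
implicit function theorem in the space of curves gives the solutions for small `ε`, depending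
smoothly on `(ε, x)`, and these are the only solutions near the constant curve. -/
theorem exists_smooth_curve_family [CompleteSpace E] {v : E → E} (hv : ContDiff ℝ ∞ v) (x₀ : E) :
    ∃ Γ : ℝ × E → C(CurveInterval, E), ∃ r > 0,
      (∀ p ∈ Metric.ball ((0 : ℝ), x₀) r, ContDiffAt ℝ ∞ Γ p ∧
        flowDefect ⟨v, hv.continuous⟩ (p, Γ p) = 0 ∧
        ∀ t : CurveInterval, Γ (p.1 * t, p.2) = (Γ p).comp (scaleInterval t)) := by
  set V : C(E, E) := ⟨v, hv.continuous⟩ with hV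
  set γ₀ := constCurveCLM E x₀ with hγ₀
  have hD := contDiff_flowDefect hv
  let G : (ℝ × E) × C(CurveInterval, E) → (ℝ × E) × C(CurveInterval, E) :=
    fun p => (p.1, flowDefect V p)
  have hG : ContDiff ℝ ∞ G := contDiff_fst.prodMk hD
  let B : ℝ × E →L[ℝ] C(CurveInterval, E) :=
    (constCurveCLM E).comp (ContinuousLinearMap.snd ℝ ℝ E) +
      (ContinuousLinearMap.fst ℝ ℝ E).smulRight (curveIntegralCLM E (V.comp γ₀))
  let e : ((ℝ × E) × C(CurveInterval, E)) ≃L[ℝ] (ℝ × E) × C(CurveInterval, E) :=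
    ContinuousLinearEquiv.equivOfInverse
      ((ContinuousLinearMap.fst ℝ _ _).prod
        (ContinuousLinearMap.snd ℝ _ _ - B.comp (ContinuousLinearMap.fst ℝ _ _)))
      ((ContinuousLinearMap.fst ℝ _ _).prod
        (ContinuousLinearMap.snd ℝ _ _ + B.comp (ContinuousLinearMap.fst ℝ _ _)))
      (fun p => by ext <;> simp) (fun p => by ext <;> simp)
  let a : (ℝ × E) × C(CurveInterval, E) := ((0, x₀), γ₀)
  have hGa : G a = ((0, x₀), 0) := by
    refine Prod.ext rfl ?_
    simp [G, a, flowDefect, hγ₀]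
  have hGd : HasFDerivAt G (e : _ →L[ℝ] _) a := by
    refine HasFDerivAt.prodMk hasFDerivAt_fst ?_
    have hcomp : HasFDerivAt (fun p : (ℝ × E) × C(CurveInterval, E) =>
        curveIntegralCLM E (V.comp p.2)) (fderiv ℝ (fun p : (ℝ × E) × C(CurveInterval, E) =>
        curveIntegralCLM E (V.comp p.2)) a) a := by
      have : ContDiff ℝ ∞ (fun p : (ℝ × E) × C(CurveInterval, E) =>
        curveIntegralCLM E (V.comp p.2)) :=
        (curveIntegralCLM E).contDiff.comp (hv.contDiff_postcomp.comp contDiff_snd)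
      exact (this.differentiable (by simp) a).hasFDerivAt
    have h1 := ((ContinuousLinearMap.snd ℝ (ℝ × E) C(CurveInterval, E)).hasFDerivAt (x := a)).sub
      (((constCurveCLM E).comp ((ContinuousLinearMap.snd ℝ ℝ E).comp
        (ContinuousLinearMap.fst ℝ (ℝ × E) C(CurveInterval, E)))).hasFDerivAt (x := a))
    have h2 := (((ContinuousLinearMap.fst ℝ ℝ E).comp
        (ContinuousLinearMap.fst ℝ (ℝ × E) C(CurveInterval, E))).hasFDerivAt (x := a)).smul hcomp
    refine (h1.sub h2).congr_fderiv ?_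
    refine ContinuousLinearMap.ext fun p => ?_
    simp [a, B, hγ₀]
    abel
  obtain ⟨g, hga, hg1, hg2⟩ := hG.exists_smooth_local_inverse hGd
  rw [hGa] at hga hg1
  let j : ℝ × E → (ℝ × E) × C(CurveInterval, E) := fun p => (p, 0)
  have hj : ContDiff ℝ ∞ j := contDiff_id.prodMk contDiff_const
  let Γ : ℝ × E → C(CurveInterval, E) := fun p => (g (j p)).2
  have hg1' : ∀ᶠ p in 𝓝 ((0 : ℝ), x₀), ContDiffAt ℝ ∞ g (j p) ∧ G (g (j p)) = j p :=
    hj.continuous.continuousAt.eventually hg1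
  have hΓ1 : ∀ᶠ p in 𝓝 ((0 : ℝ), x₀), ContDiffAt ℝ ∞ Γ p ∧ flowDefect V (p, Γ p) = 0 := by
    filter_upwards [hg1'] with p ⟨hp1, hp2⟩
    refine ⟨contDiffAt_snd.comp p (hp1.comp p hj.contDiffAt), ?_⟩
    have e1 : (g (j p)).1 = p := congrArg Prod.fst hp2
    have e2 : flowDefect V (g (j p)) = 0 := congrArg Prod.snd hp2
    rwa [← e1, show Γ (g (j p)).1 = (g (j p)).2 by rw [e1]]
  have hΓ0 : Γ (0, x₀) = γ₀ := by simp [Γ, j, hga, a]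
  have hΓc : ContinuousAt Γ (0, x₀) := (hΓ1.self_of_nhds).1.continuousAt
  -- uniqueness near the constant curve
  obtain ⟨δ, hδ, hδu⟩ := Metric.eventually_nhds_iff_ball.1 hg2
  have huniq : ∀ p γ, p ∈ Metric.ball ((0 : ℝ), x₀) δ → γ ∈ Metric.ball γ₀ δ →
      flowDefect V (p, γ) = 0 → γ = Γ p := by
    intro p γ hp hγ h0
    have h1 := hδu (p, γ) (by
      rw [← ball_prod_same]
      exact ⟨hp, hγ⟩)
    have h2 : G (p, γ) = j p := Prod.ext rfl h0
    rw [h2] at h1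
    exact (congrArg Prod.snd h1).symm
  have hnear : ∀ᶠ p in 𝓝 ((0 : ℝ), x₀), Γ p ∈ Metric.ball γ₀ δ := by
    apply hΓc
    rw [hΓ0]
    exact Metric.ball_mem_nhds _ hδ
  obtain ⟨r, hr, hrb⟩ := Metric.eventually_nhds_iff_ball.1
    ((hΓ1.and hnear).and (eventually_mem_set.2 (Metric.ball_mem_nhds ((0 : ℝ), x₀) hδ)))
  refine ⟨Γ, r, hr, fun p hp => ?_⟩
  obtain ⟨⟨⟨hp1, hp2⟩, hp3⟩, hp4⟩ := hrb p hp
  refine ⟨hp1, hp2, fun t => ?_⟩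
  symm
  refine huniq _ _ ?_ ?_ (flowDefect_comp_scaleInterval hp2 t)
  · rw [← ball_prod_same] at hp4 ⊢
    refine ⟨?_, hp4.2⟩
    have h1 : |p.1| < δ := by simpa [Real.dist_eq] using hp4.1
    rw [Metric.mem_ball, Real.dist_eq, sub_zero, abs_mul]
    exact lt_of_le_of_lt (mul_le_of_le_one_right (abs_nonneg _) (abs_le.2 t.2)) h1
  · rw [Metric.mem_ball] at hp3 ⊢
    refine lt_of_le_of_lt ?_ hp3
    rw [ContinuousMap.dist_le dist_nonneg]
    intro s
    exact ContinuousMap.dist_apply_le_dist (f := Γ p) (g := γ₀) (scaleInterval t s)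

/-- A smooth vector field on a finite-dimensional space has a smooth local flow. -/
theorem ContDiff.exists_smooth_local_flow [FiniteDimensional ℝ E] {v : E → E}
    (hv : ContDiff ℝ ∞ v) (x₀ : E) :
    ∃ φ : ℝ × E → E, ContDiff ℝ ∞ φ ∧ (∀ᶠ x in 𝓝 x₀, φ (0, x) = x) ∧
      ∀ᶠ p in 𝓝 ((0 : ℝ), x₀), HasDerivAt (fun t => φ (t, p.2)) (v (φ p)) p.1 := by
  have := FiniteDimensional.complete ℝ E
  obtain ⟨Γ, r, hr, hΓ⟩ := exists_smooth_curve_family hv x₀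
  let one : CurveInterval := ⟨1, by norm_num⟩
  let φ₀ : ℝ × E → E := fun p => Γ p one
  have hφ₀ : ContDiffOn ℝ ∞ φ₀ (Metric.ball (0, x₀) r) := fun p hp =>
    ((ContinuousMap.evalCLM ℝ one : C(CurveInterval, E) →L[ℝ] E).contDiff.contDiffAt.comp p
      (hΓ p hp).1).contDiffWithinAt
  obtain ⟨φ, hφ, hφe⟩ := hφ₀.exists_contDiff_eventuallyEq (Metric.ball_mem_nhds _ hr)
  refine ⟨φ, hφ, ?_, ?_⟩
  · have hc : ContinuousAt (fun x : E => ((0 : ℝ), x)) x₀ := by fun_prop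
    filter_upwards [hc.eventually hφe, hc.eventually (Metric.ball_mem_nhds _ hr)] with x hx hxr
    rw [hx]
    have := flowDefect_eq_zero_iff.1 (hΓ _ hxr).2.1 one
    simpa using this
  · have hU : ∀ᶠ p in 𝓝 ((0 : ℝ), x₀), p ∈ Metric.ball ((0 : ℝ), x₀) (r / 2) :=
      Metric.ball_mem_nhds _ (by positivity)
    filter_upwards [hU, hφe.eventually_nhds] with p hp hpe
    have hpr : |p.1| < r / 2 ∧ p.2 ∈ Metric.ball x₀ (r / 2) := by
      rw [← ball_prod_same] at hp
      exact ⟨by simpa [Real.dist_eq] using hp.1, hp.2⟩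
    -- all the times `|τ| < ε := r / 2` are reached along the single curve `Γ (ε, x)`
    have hq : ((r / 2, p.2) : ℝ × E) ∈ Metric.ball ((0 : ℝ), x₀) r := by
      rw [← ball_prod_same]
      refine ⟨?_, Metric.ball_subset_ball (by linarith) hpr.2⟩
      rw [Metric.mem_ball, Real.dist_eq, sub_zero, abs_of_pos (by positivity)]
      linarith
    obtain ⟨-, hsol, hscale⟩ := hΓ _ hq
    set γ := Γ (r / 2, p.2) with hγ
    have hmem : ∀ τ : ℝ, |τ| < r / 2 → τ / (r / 2) ∈ Icc (-1 : ℝ) 1 := by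
      intro τ hτ
      rw [mem_Icc, ← abs_le, abs_div, abs_of_pos (by positivity : 0 < r / 2)]
      exact (div_le_one (by positivity)).2 hτ.le
    have hcurve : ∀ τ : ℝ, |τ| < r / 2 → φ₀ (τ, p.2) = curveExtend γ (τ / (r / 2)) := by
      intro τ hτ
      have ht := hmem τ hτ
      have h1 := hscale ⟨_, ht⟩
      have h2 : r / 2 * (τ / (r / 2)) = τ := by field_simp
      simp only [h2] at h1
      rw [curveExtend_of_mem _ ht]
      change Γ (τ, p.2) one = _
      rw [h1]
      change γ _ = γ _
      congr 1
      exact Subtype.ext (mul_one _)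
    have hint : ∀ τ : ℝ, |τ| < r / 2 → φ₀ (τ, p.2)
        = p.2 + (r / 2) • ∫ s in (0 : ℝ)..(τ / (r / 2)), v (curveExtend γ s) := by
      intro τ hτ
      have ht := hmem τ hτ
      rw [hcurve τ hτ, curveExtend_of_mem _ ht]
      exact flowDefect_eq_zero_iff.1 hsol ⟨_, ht⟩
    have hcont : Continuous fun s => v (curveExtend γ s) :=
      hv.continuous.comp (continuous_curveExtend γ)
    have hder : HasDerivAt (fun τ : ℝ => p.2 + (r / 2) •
        ∫ s in (0 : ℝ)..(τ / (r / 2)), v (curveExtend γ s)) (v (φ p)) p.1 := by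
      have h1 : HasDerivAt (fun u : ℝ => ∫ s in (0 : ℝ)..u, v (curveExtend γ s))
          (v (curveExtend γ (p.1 / (r / 2)))) (p.1 / (r / 2)) :=
        intervalIntegral.integral_hasDerivAt_right (hcont.intervalIntegrable _ _)
          (hcont.stronglyMeasurableAtFilter _ _) hcont.continuousAt
      have h2 : HasDerivAt (fun τ : ℝ => τ / (r / 2)) (1 / (r / 2)) p.1 :=
        (hasDerivAt_id _).div_const _
      have h3 := ((HasDerivAt.scomp p.1 h1 h2).const_smul (r / 2)).const_add p.2
      rw [smul_smul, mul_one_div_cancel (by positivity), one_smul] at h3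
      rw [hpe.self_of_nhds, hcurve p.1 hpr.1]
      exact h3
    refine hder.congr_of_eventuallyEq ?_
    have hc : ContinuousAt (fun τ : ℝ => (τ, p.2)) p.1 := by fun_prop
    have hlt : ∀ᶠ τ in 𝓝 p.1, |τ| < r / 2 :=
      (continuous_abs.isOpen_preimage _ isOpen_Iio).mem_nhds hpr.1
    filter_upwards [hc.eventually hpe, hlt] with τ hτ hτr
    rw [hτ, hint τ hτr]

end Flow

/-! ### Local solution of the Poisson equation -/

section Poisson

open FourierTransform RealInnerProductSpace

variable {V : Type*} [NormedAddCommGroup V] [InnerProductSpace ℝ V]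

/-- The Fourier multiplier `(1 - e^{2πi⟨v, b⟩})² / (-4π²‖v‖²)`: the symbol of the inverse Laplacian
times that of the square of the difference operator `F ↦ F - F (· - b)`, which makes it bounded. -/
def poissonSymbol (b v : V) : ℂ :=
  (1 - (Real.fourierChar ⟪v, b⟫ : ℂ)) ^ 2 / (-(4 * Real.pi ^ 2 * ‖v‖ ^ 2) : ℝ)

theorem norm_one_sub_fourierChar_le (t : ℝ) :
    ‖1 - (Real.fourierChar t : ℂ)‖ ≤ 2 * Real.pi * |t| := by
  rw [norm_sub_rev, Real.fourierChar_apply, mul_comm _ Complex.I]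
  refine (Real.norm_exp_I_mul_ofReal_sub_one_le).trans (le_of_eq ?_)
  rw [Real.norm_eq_abs, abs_mul, abs_of_pos (by positivity : 0 < 2 * Real.pi)]

theorem norm_poissonSymbol_le (b v : V) : ‖poissonSymbol b v‖ ≤ ‖b‖ ^ 2 := by
  by_cases hv : v = 0
  · simp [poissonSymbol, hv]
  have hv' : 0 < ‖v‖ := norm_pos_iff.2 hv
  have h1 : ‖1 - (Real.fourierChar ⟪v, b⟫ : ℂ)‖ ≤ 2 * Real.pi * (‖v‖ * ‖b‖) :=
    (norm_one_sub_fourierChar_le _).trans (by gcongr; exact abs_real_inner_le_norm v b)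
  rw [poissonSymbol, norm_div, norm_pow, Complex.norm_real, norm_neg,
    Real.norm_of_nonneg (by positivity), div_le_iff₀ (by positivity)]
  calc _ ≤ (2 * Real.pi * (‖v‖ * ‖b‖)) ^ 2 := by gcongr
    _ = _ := by ring

theorem poissonSymbol_mul (b v : V) :
    (-(4 * Real.pi ^ 2 * ‖v‖ ^ 2) : ℝ) * poissonSymbol b v
      = (1 - (Real.fourierChar ⟪v, b⟫ : ℂ)) ^ 2 := by
  by_cases hv : v = 0
  · simp [poissonSymbol, hv]
  have hv' : (-(4 * Real.pi ^ 2 * ‖v‖ ^ 2) : ℝ) ≠ 0 := by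
    have := norm_pos_iff.2 hv
    have := Real.pi_pos
    exact neg_ne_zero.2 (by positivity)
  rw [poissonSymbol, mul_div_cancel₀]
  exact_mod_cast hv'

theorem measurable_poissonSymbol [MeasurableSpace V] [BorelSpace V] (b : V) :
    Measurable (poissonSymbol b) := by
  unfold poissonSymbol
  refine Measurable.div ?_ ?_
  · refine Continuous.measurable ?_
    have : Continuous fun t : ℝ => (Real.fourierChar t : ℂ) := by
      simp only [Real.fourierChar_apply]; fun_prop
    have h2 : Continuous fun v : V => (⟪v, b⟫ : ℝ) := by fun_prop
    have := this.comp h2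
    exact (continuous_const.sub this).pow 2
  · exact Continuous.measurable (by fun_prop)

variable [FiniteDimensional ℝ V] [MeasurableSpace V] [BorelSpace V]

/-- All absolute moments of `g` are finite; the Fourier transform of such a function is smooth. -/
structure HasFiniteMoments (g : V → ℂ) : Prop where
  aestronglyMeasurable : AEStronglyMeasurable g
  integrable_pow_mul : ∀ k : ℕ, Integrable fun v => ‖v‖ ^ k * ‖g v‖

namespace HasFiniteMoments

variable {g : V → ℂ}

theorem integrable (hg : HasFiniteMoments g) : Integrable g := by
  rw [← integrable_norm_iff hg.aestronglyMeasurable]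
  simpa using hg.integrable_pow_mul 0

theorem contDiff_fourier (hg : HasFiniteMoments g) : ContDiff ℝ ∞ (𝓕 g) :=
  Real.contDiff_fourier fun n _ => hg.integrable_pow_mul n

theorem of_bound (hg : HasFiniteMoments g) {h : V → ℂ} (hh : AEStronglyMeasurable h) {C : ℝ} {j : ℕ}
    (hb : ∀ v, ‖h v‖ ≤ C * ‖v‖ ^ j * ‖g v‖) : HasFiniteMoments h := by
  refine ⟨hh, fun k => ?_⟩
  refine ((hg.integrable_pow_mul (k + j)).const_mul C).mono'
    ((continuous_norm.pow k).aestronglyMeasurable.mul hh.norm) (ae_of_all _ fun v => ?_)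
  rw [Real.norm_of_nonneg (by positivity)]
  calc ‖v‖ ^ k * ‖h v‖ ≤ ‖v‖ ^ k * (C * ‖v‖ ^ j * ‖g v‖) := by gcongr; exact hb v
    _ = C * (‖v‖ ^ (k + j) * ‖g v‖) := by ring

theorem inner_mul (hg : HasFiniteMoments g) (e : V) :
    HasFiniteMoments fun v => (-(2 * Real.pi * Complex.I) * ⟪v, e⟫) * g v := by
  refine hg.of_bound (C := 2 * Real.pi * ‖e‖) (j := 1) ?_ fun v => ?_
  · refine (Continuous.aestronglyMeasurable ?_).mul hg.aestronglyMeasurable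
    fun_prop
  · have h1 : ‖(-(2 * Real.pi * Complex.I) * (⟪v, e⟫ : ℂ))‖ = 2 * Real.pi * |⟪v, e⟫| := by
      simp [abs_of_pos Real.pi_pos]
    rw [norm_mul, h1]
    have := abs_real_inner_le_norm v e
    calc 2 * Real.pi * |⟪v, e⟫| * ‖g v‖ ≤ 2 * Real.pi * (‖v‖ * ‖e‖) * ‖g v‖ := by gcongr
      _ = _ := by ring

/-- A directional derivative of a Fourier transform. -/
theorem fderiv_fourier_apply (hg : HasFiniteMoments g) (x e : V) :
    fderiv ℝ (𝓕 g) x e = 𝓕 (fun v => (-(2 * Real.pi * Complex.I) * ⟪v, e⟫) * g v) x := by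
  have h1 : Integrable fun v => ‖v‖ * ‖g v‖ := by simpa using hg.integrable_pow_mul 1
  rw [(Real.hasFDerivAt_fourier hg.integrable h1 x).fderiv]
  have h2 : Integrable (VectorFourier.fourierSMulRight (innerSL ℝ) g) := by
    refine (h1.const_mul (2 * Real.pi * ‖innerSL ℝ (E := V)‖)).mono'
      hg.aestronglyMeasurable.fourierSMulRight (ae_of_all _ fun v => ?_)
    exact (VectorFourier.norm_fourierSMulRight_le _ _ _).trans (le_of_eq (by ring))
  rw [Real.fourier_continuousLinearMap_apply h2]
  refine congrArg (fun f : V → ℂ => 𝓕 f x) (funext fun v => ?_)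
  rw [VectorFourier.fourierSMulRight_apply, show innerSL ℝ v e = ⟪v, e⟫ from rfl,
    Complex.real_smul, smul_eq_mul]
  ring

end HasFiniteMoments

/-- Modulation by a character translates the Fourier transform. -/
theorem fourier_fourierChar_mul (G : V → ℂ) (b x : V) :
    𝓕 (fun v => (Real.fourierChar ⟪v, b⟫ : ℂ) * G v) x = 𝓕 G (x - b) := by
  rw [Real.fourier_eq, Real.fourier_eq]
  congr 1
  ext v
  rw [inner_sub_right, neg_sub, sub_eq_add_neg, AddChar.map_add_eq_mul, Circle.smul_def,
    Circle.smul_def, Circle.coe_mul, smul_eq_mul, smul_eq_mul]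
  ring

/-- Second differences of a compactly supported smooth function are Laplacians of smooth functions,
on the whole space: divide by the symbol of the Laplacian on the Fourier side. -/
theorem exists_laplacian_eq_second_difference {ι : Type*} [Fintype ι] (β : OrthonormalBasis ι ℝ V)
    {F : V → ℂ} (hF : ContDiff ℝ ∞ F) (hFc : HasCompactSupport F) (b : V) :
    ∃ S : V → ℂ, ContDiff ℝ ∞ S ∧ ∀ x,
      ∑ i, fderiv ℝ (fun y => fderiv ℝ S y (β i)) x (β i)
        = F x - 2 * F (x - b) + F (x - (2 : ℝ) • b) := by
  let Fs : SchwartzMap V ℂ := hFc.toSchwartzMap hF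
  let G : SchwartzMap V ℂ := 𝓕⁻ Fs
  have hGF : 𝓕 (G : V → ℂ) = F := by
    rw [← SchwartzMap.fourier_coe, FourierTransform.fourier_fourierInv_eq]
    rfl
  have hG : HasFiniteMoments (G : V → ℂ) :=
    ⟨G.continuous.aestronglyMeasurable, fun k => G.integrable_pow_mul volume k⟩
  have hg : HasFiniteMoments fun v => poissonSymbol b v * G v := by
    refine hG.of_bound (C := ‖b‖ ^ 2) (j := 0)
      ((measurable_poissonSymbol b).aestronglyMeasurable.mul hG.aestronglyMeasurable) fun v => ?_
    rw [norm_mul, pow_zero, mul_one]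
    gcongr
    exact norm_poissonSymbol_le b v
  refine ⟨𝓕 fun v => poissonSymbol b v * G v, hg.contDiff_fourier, fun x => ?_⟩
  have h1 : ∀ i, fderiv ℝ (fun y => fderiv ℝ (𝓕 fun v => poissonSymbol b v * G v) y (β i)) x (β i)
      = 𝓕 (fun v => (-(2 * Real.pi * Complex.I) * ⟪v, β i⟫) *
        ((-(2 * Real.pi * Complex.I) * ⟪v, β i⟫) * (poissonSymbol b v * G v))) x := by
    intro i
    rw [← (hg.inner_mul (β i)).fderiv_fourier_apply]
    congr 2
    ext y
    exact hg.fderiv_fourier_apply y (β i)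
  have hint : ∀ i, Integrable fun v => Real.fourierChar (-⟪v, x⟫) •
      ((-(2 * Real.pi * Complex.I) * ⟪v, β i⟫) *
        ((-(2 * Real.pi * Complex.I) * ⟪v, β i⟫) * (poissonSymbol b v * G v))) := fun i =>
    (Real.fourierIntegral_convergent_iff x).2 ((hg.inner_mul (β i)).inner_mul (β i)).integrable
  have hchar : ∀ c : V, Integrable fun v => Real.fourierChar (-⟪v, x⟫) •
      ((Real.fourierChar ⟪v, c⟫ : ℂ) * G v) := by
    intro c
    have : Integrable fun v => Real.fourierChar (-⟪v, x - c⟫) • G v :=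
      (Real.fourierIntegral_convergent_iff (x - c)).2 hG.integrable
    refine this.congr (ae_of_all _ fun v => ?_)
    simp only [inner_sub_right]
    rw [neg_sub, sub_eq_add_neg, AddChar.map_add_eq_mul, Circle.smul_def,
      Circle.smul_def, Circle.coe_mul, smul_eq_mul, smul_eq_mul]
    ring
  have hG0 : Integrable fun v => Real.fourierChar (-⟪v, x⟫) • G v :=
    (Real.fourierIntegral_convergent_iff x).2 hG.integrable
  have hA : Integrable fun v => Real.fourierChar (-⟪v, x⟫) • G v -
      2 * Real.fourierChar (-⟪v, x⟫) • ((Real.fourierChar ⟪v, b⟫ : ℂ) * G v) :=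
    hG0.sub ((hchar b).const_mul 2)
  rw [Finset.sum_congr rfl fun i _ => h1 i]
  have h2 : F x = 𝓕 (G : V → ℂ) x := by rw [hGF]
  have h3 : ∀ c, F (x - c) = 𝓕 (fun v => (Real.fourierChar ⟪v, c⟫ : ℂ) * G v) x := by
    intro c; rw [fourier_fourierChar_mul, hGF]
  rw [h3, h3, h2]
  simp only [Real.fourier_eq]
  rw [← integral_finsetSum _ fun i _ => hint i, ← integral_const_mul,
    ← integral_sub hG0 ((hchar b).const_mul 2),
    ← integral_add hA (hchar _)]
  congr 1
  ext v
  have hsum : ∑ i, ((⟪v, β i⟫ : ℝ) : ℂ) ^ 2 = (‖v‖ ^ 2 : ℝ) := by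
    rw [← β.sum_sq_inner_left v]
    push_cast
    rfl
  have hI : Complex.I ^ 2 = -1 := Complex.I_sq
  have hsq : (Real.fourierChar ⟪v, (2 : ℝ) • b⟫ : ℂ) = (Real.fourierChar ⟪v, b⟫ : ℂ) ^ 2 := by
    rw [inner_smul_right, two_mul, AddChar.map_add_eq_mul, Circle.coe_mul, sq]
  calc ∑ i, Real.fourierChar (-⟪v, x⟫) • ((-(2 * Real.pi * Complex.I) * (⟪v, β i⟫ : ℂ)) *
        ((-(2 * Real.pi * Complex.I) * ⟪v, β i⟫) * (poissonSymbol b v * G v)))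
      = (Real.fourierChar (-⟪v, x⟫) : ℂ) * (-(4 * Real.pi ^ 2) *
          (∑ i, ((⟪v, β i⟫ : ℝ) : ℂ) ^ 2) * poissonSymbol b v * G v) := by
        rw [Finset.mul_sum, Finset.sum_mul, Finset.sum_mul, Finset.mul_sum]
        refine Finset.sum_congr rfl fun i _ => ?_
        rw [Circle.smul_def, smul_eq_mul]
        linear_combination (4 * (Real.fourierChar (-⟪v, x⟫) : ℂ) * Real.pi ^ 2 *
          (⟪v, β i⟫ : ℂ) ^ 2 * poissonSymbol b v * G v) * hI
    _ = (Real.fourierChar (-⟪v, x⟫) : ℂ) *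
          ((1 - (Real.fourierChar ⟪v, b⟫ : ℂ)) ^ 2 * G v) := by
        rw [← poissonSymbol_mul, hsum]
        push_cast
        ring
    _ = _ := by
        rw [hsq]
        simp only [Circle.smul_def, smul_eq_mul]
        ring

/-- The Poisson equation is smoothly solvable near each point. The right-hand side is cut off to
the unit ball, and replaced by a second difference with a step `b` so long that the two additional
translates vanish near the point. -/
theorem ContDiff.exists_laplacian_eventuallyEq [Nontrivial V] {ι : Type*} [Fintype ι]
    (β : OrthonormalBasis ι ℝ V) {f : V → ℝ} (hf : ContDiff ℝ ∞ f) (x₀ : V) :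
    ∃ S : V → ℝ, ContDiff ℝ ∞ S ∧ ∀ᶠ x in 𝓝 x₀,
      ∑ i, fderiv ℝ (fun y => fderiv ℝ S y (β i)) x (β i) = f x := by
  let χ : ContDiffBump x₀ := ⟨1 / 2, 1, by norm_num, by norm_num⟩
  let F : V → ℂ := fun x => ((χ x * f x : ℝ) : ℂ)
  have hF : ContDiff ℝ ∞ F := Complex.ofRealCLM.contDiff.comp (χ.contDiff.mul hf)
  have hFc : HasCompactSupport F :=
    (χ.hasCompactSupport.mul_right (f' := f)).comp_left (g := fun t : ℝ => (t : ℂ))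
      Complex.ofReal_zero
  obtain ⟨b, hb⟩ := exists_norm_eq V (by norm_num : (0 : ℝ) ≤ 4)
  obtain ⟨S, hS, hSF⟩ := exists_laplacian_eq_second_difference β hF hFc b
  refine ⟨fun x => (S x).re, Complex.reCLM.contDiff.comp hS, ?_⟩
  have hzero : ∀ y, 1 ≤ Dist.dist y x₀ → F y = 0 := by
    intro y hy
    have : χ y = 0 := χ.zero_of_le_dist hy
    simp [F, this]
  filter_upwards [χ.eventuallyEq_one, Metric.ball_mem_nhds x₀ one_pos] with x hx hxb
  have hfd : ∀ (T : V → ℂ), ContDiff ℝ ∞ T → ∀ y e,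
      fderiv ℝ (fun z => (T z).re) y e = (fderiv ℝ T y e).re := by
    intro T hT y e
    have h := Complex.reCLM.hasFDerivAt.comp y (hT.differentiable (by simp) y).hasFDerivAt
    exact congrArg (fun L : V →L[ℝ] ℝ => L e) h.fderiv
  have h1 : ∀ i, fderiv ℝ (fun y => fderiv ℝ (fun z => (S z).re) y (β i)) x (β i)
      = (fderiv ℝ (fun y => fderiv ℝ S y (β i)) x (β i)).re := by
    intro i
    rw [← hfd (fun y => fderiv ℝ S y (β i))
      ((contDiff_infty_iff_fderiv.1 hS).2.clm_apply contDiff_const)]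
    congr 2
    ext y
    exact hfd S hS y (β i)
  rw [Finset.sum_congr rfl fun i _ => h1 i, ← Complex.re_sum, hSF x]
  have hd : Dist.dist x x₀ < 1 := hxb
  rw [dist_eq_norm] at hd
  have hfar : ∀ c : V, 4 ≤ ‖c‖ → F (x - c) = 0 := by
    intro c hc
    refine hzero _ ?_
    rw [dist_eq_norm, sub_right_comm]
    have := norm_sub_norm_le c (x - x₀)
    rw [norm_sub_rev c (x - x₀)] at this
    linarith
  rw [hfar b hb.ge, hfar _ (by rw [norm_smul, hb]; norm_num)]
  simp [F, hx]

end Poisson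

/-! ### Straightening a vector field -/

/-- A smooth vector field `v` is the image of the constant field `e` in suitable smooth local
coordinates `g`, with inverse `Ψ`, near a point where it does not vanish. With a linear
isomorphism `A` such that `A e = v x₀`, the map `Ψ` follows the flow for the time `ℓ y` from the
point `x₀ + A (y - ℓ(y) e)` of a transversal hyperplane. -/
theorem ContDiff.exists_straightening {E : Type*} [NormedAddCommGroup E] [NormedSpace ℝ E]
    [FiniteDimensional ℝ E] {v : E → E} (hv : ContDiff ℝ ∞ v) {x₀ : E} (hv₀ : v x₀ ≠ 0)
    (ℓ : E →L[ℝ] ℝ) {e : E} (he : ℓ e = 1) :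
    ∃ Ψ g : E → E, ContDiff ℝ ∞ Ψ ∧ ContDiff ℝ ∞ g ∧ Ψ 0 = x₀ ∧ g x₀ = 0 ∧
      (∀ᶠ x in 𝓝 x₀, Ψ (g x) = x ∧ fderiv ℝ g x (v x) = e) ∧
      ∀ᶠ y in 𝓝 (0 : E), fderiv ℝ Ψ y e = v (Ψ y) := by
  have := FiniteDimensional.complete ℝ E
  obtain ⟨φ, hφ, hφ0, hφt⟩ := hv.exists_smooth_local_flow x₀
  have he0 : e ≠ 0 := by rintro rfl; simp at he
  obtain ⟨A, hA⟩ := SeparatingDual.exists_continuousLinearEquiv_apply_eq (R := ℝ) he0 hv₀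
  let P : E →L[ℝ] E := ContinuousLinearMap.id ℝ E - ℓ.smulRight e
  have hPe : P e = 0 := by simp [P, he]
  let Λ : E →L[ℝ] ℝ × E := ℓ.prod ((A : E →L[ℝ] E).comp P)
  let κ : E → ℝ × E := fun y => (0, x₀) + Λ y
  have hκ : ContDiff ℝ ∞ κ := contDiff_const.add Λ.contDiff
  have hκd : ∀ y, HasFDerivAt κ Λ y := fun y => Λ.hasFDerivAt.const_add _
  have hκ0 : κ 0 = (0, x₀) := by simp [κ]
  let Ψ : E → E := fun y => φ (κ y)
  have hΨ : ContDiff ℝ ∞ Ψ := hφ.comp hκ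
  have hφd : ∀ p, HasFDerivAt φ (fderiv ℝ φ p) p := fun p =>
    (hφ.differentiable (by simp) p).hasFDerivAt
  have hΨd : ∀ y, HasFDerivAt Ψ ((fderiv ℝ φ (κ y)).comp Λ) y := fun y =>
    (hφd (κ y)).comp y (hκd y)
  have hΛe : Λ e = (1, 0) := by simp [Λ, he, hPe]
  have htime : ∀ᶠ p in 𝓝 ((0 : ℝ), x₀), fderiv ℝ φ p (1, 0) = v (φ p) := by
    filter_upwards [hφt] with p hp
    have h1 : HasDerivAt (fun t : ℝ => (t, p.2)) ((1 : ℝ), (0 : E)) p.1 :=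
      (hasDerivAt_id _).prodMk (hasDerivAt_const _ _)
    exact ((hφd p).comp_hasDerivAt p.1 h1).unique hp
  have hspace : ∀ u, fderiv ℝ φ (0, x₀) (0, u) = u := by
    intro u
    have h1 : HasFDerivAt (fun x : E => φ (0, x))
        ((fderiv ℝ φ (0, x₀)).comp (ContinuousLinearMap.inr ℝ ℝ E)) x₀ :=
      (hφd (0, x₀)).comp x₀ (hasFDerivAt_prodMk_right 0 x₀)
    have h2 : HasFDerivAt (fun x : E => φ (0, x)) (ContinuousLinearMap.id ℝ E) x₀ :=
      (hasFDerivAt_id x₀).congr_of_eventuallyEq hφ0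
    exact congrArg (fun L : E →L[ℝ] E => L u) (h1.unique h2)
  have hΨ0 : Ψ 0 = x₀ := by
    change φ (κ 0) = x₀
    rw [hκ0]
    exact hφ0.self_of_nhds
  have hΨA : HasFDerivAt Ψ (A : E →L[ℝ] E) 0 := by
    refine (hΨd 0).congr_fderiv (ContinuousLinearMap.ext fun w => ?_)
    rw [hκ0]
    have h1 : Λ w = ℓ w • ((1 : ℝ), (0 : E)) + (0, A (P w)) := by simp [Λ]
    have h2 : fderiv ℝ φ (0, x₀) (1, 0) = A e := by
      have h3 : φ (0, x₀) = x₀ := hφ0.self_of_nhds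
      rw [htime.self_of_nhds, h3, hA]
    rw [ContinuousLinearMap.comp_apply, h1, map_add, map_smul, hspace, h2]
    simp [P]
  have hΨe : ∀ᶠ y in 𝓝 (0 : E), fderiv ℝ Ψ y e = v (Ψ y) := by
    have hc : Tendsto κ (𝓝 0) (𝓝 (0, x₀)) := hκ0 ▸ hκ.continuous.tendsto 0
    filter_upwards [hc.eventually htime] with y hy
    rw [(hΨd y).fderiv, ContinuousLinearMap.comp_apply, hΛe, hy]
  obtain ⟨g₀, hg0, hg1, hg2⟩ := hΨ.exists_smooth_local_inverse hΨA
  rw [hΨ0] at hg0 hg1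
  obtain ⟨U, hU, hUo, hUx⟩ := eventually_nhds_iff.1 hg1
  obtain ⟨g, hg, hgg⟩ := ContDiffOn.exists_contDiff_eventuallyEq
    (fun x hx => (hU x hx).1.contDiffWithinAt) (hUo.mem_nhds hUx)
  have hgx : g x₀ = 0 := hgg.self_of_nhds.trans hg0
  have hgΨ : ∀ᶠ y in 𝓝 (0 : E), g (Ψ y) = y := by
    have hc : Tendsto Ψ (𝓝 0) (𝓝 x₀) := hΨ0 ▸ hΨ.continuous.tendsto 0
    filter_upwards [hg2, hc.eventually hgg] with y hy1 hy2
    rw [hy2, hy1]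
  refine ⟨Ψ, g, hΨ, hg, hΨ0, hgx, ?_, hΨe⟩
  have hc : Tendsto g (𝓝 x₀) (𝓝 0) := hgx ▸ hg.continuous.tendsto x₀
  filter_upwards [hg1, hgg, hc.eventually hΨe, hc.eventually hgΨ.eventually_nhds]
    with x hx1 hx2 hx3 hx4
  have h1 : Ψ (g x) = x := by rw [hx2, hx1.2]
  refine ⟨h1, ?_⟩
  have h2 : HasFDerivAt (fun y => g (Ψ y)) ((fderiv ℝ g x).comp (fderiv ℝ Ψ (g x))) (g x) := by
    refine HasFDerivAt.comp (g x) ?_ (hΨ.differentiable (by simp) _).hasFDerivAt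
    rw [h1]
    exact (hg.differentiable (by simp) _).hasFDerivAt
  have h3 : HasFDerivAt (fun y => g (Ψ y)) (ContinuousLinearMap.id ℝ E) (g x) :=
    (hasFDerivAt_id _).congr_of_eventuallyEq hx4
  have h4 := congrArg (fun L : E →L[ℝ] E => L e) (h2.unique h3)
  simp only [ContinuousLinearMap.comp_apply, hx3, h1] at h4
  exact h4

namespace NNET

/-! ### Partial derivatives and the Nambu flow -/

variable {N : ℕ}

theorem partialDeriv_congr {f g : Space N → ℝ} {x : Space N} (h : f =ᶠ[𝓝 x] g) (i : Fin N) :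
    partialDeriv i f x = partialDeriv i g x := by
  rw [partialDeriv, partialDeriv, h.fderiv_eq]

theorem contDiff_partialDeriv {f : Space N → ℝ} (hf : ContDiff ℝ ∞ f) (i : Fin N) :
    ContDiff ℝ ∞ (partialDeriv i f) :=
  (contDiff_infty_iff_fderiv.1 hf).2.clm_apply contDiff_const

theorem contDiff_apply_coord {v : Space N → Space N} (hv : ContDiff ℝ ∞ v) (i : Fin N) :
    ContDiff ℝ ∞ fun x => v x i :=
  (EuclideanSpace.proj (𝕜 := ℝ) i).contDiff.comp hv

theorem fderiv_apply_coord {v : Space N → Space N} (hv : ContDiff ℝ ∞ v) (i : Fin N)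
    (x w : Space N) : fderiv ℝ (fun y => v y i) x w = fderiv ℝ v x w i :=
  congrArg (fun L : Space N →L[ℝ] ℝ => L w)
    ((EuclideanSpace.proj (𝕜 := ℝ) i).hasFDerivAt.comp x
      (hv.differentiable (by simp) x).hasFDerivAt).fderiv

theorem sum_single (w : Space N) : ∑ i, w i • (EuclideanSpace.single i 1 : Space N) = w := by
  ext j
  simp [Finset.sum_apply, Pi.single_apply]

theorem fderiv_eq_sum_partialDeriv (f : Space N → ℝ) (x w : Space N) :
    fderiv ℝ f x w = ∑ i, partialDeriv i f x * w i := by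
  conv_lhs => rw [← sum_single w]
  rw [map_sum]
  refine Finset.sum_congr rfl fun i _ => ?_
  rw [map_smul, smul_eq_mul, mul_comm, partialDeriv]

theorem partialDeriv_coord (i μ : Fin N) (x : Space N) :
    partialDeriv i (fun y : Space N => y μ) x = (Pi.single μ 1 : Fin N → ℝ) i := by
  have h : HasFDerivAt (fun y : Space N => y μ) (EuclideanSpace.proj (𝕜 := ℝ) μ) x :=
    (EuclideanSpace.proj (𝕜 := ℝ) μ).hasFDerivAt
  rw [partialDeriv, h.fderiv]
  simp [Pi.single_apply, eq_comm]

theorem partialDeriv_comm {f : Space N → ℝ} (hf : ContDiff ℝ ∞ f) (i j : Fin N) (x : Space N) :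
    partialDeriv i (partialDeriv j f) x = partialDeriv j (partialDeriv i f) x := by
  have hd : DifferentiableAt ℝ (fderiv ℝ f) x :=
    (contDiff_infty_iff_fderiv.1 hf).2.differentiable (by simp) x
  have h : ∀ a b : Fin N, partialDeriv a (partialDeriv b f) x
      = fderiv ℝ (fderiv ℝ f) x (EuclideanSpace.single a 1) (EuclideanSpace.single b 1) := by
    intro a b
    have := (hd.hasFDerivAt.clm_apply
      (hasFDerivAt_const (EuclideanSpace.single b (1 : ℝ) : Space N) x)).fderiv
    change fderiv ℝ (fun y => fderiv ℝ f y (EuclideanSpace.single b 1)) x _ = _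
    rw [this]
    simp
  rw [h, h]
  exact hf.contDiffAt.isSymmSndFDerivAt
    (by rw [minSmoothness_of_isRCLikeNormedField]; exact WithTop.coe_le_coe.2 le_top) _ _

/-- The Jacobian matrix of `(A_1, …, A_N)`, with the gradients as rows. -/
def jacobian (A : Fin N → Space N → ℝ) (x : Space N) : Matrix (Fin N) (Fin N) ℝ :=
  Matrix.of fun k i => partialDeriv i (A k) x

theorem nambuBracket_eq_det (A : Fin N → Space N → ℝ) (x : Space N) :
    nambuBracket A x = (jacobian A x).det := by
  rw [← Matrix.det_transpose, Matrix.det_apply']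
  rfl

theorem jacobian_mulVec (A : Fin N → Space N → ℝ) (x w : Space N) :
    (jacobian A x).mulVec (fun i => w i) = fun k => fderiv ℝ (A k) x w := by
  ext k
  rw [fderiv_eq_sum_partialDeriv]
  rfl

theorem contDiff_det_jacobian {A : Fin N → Space N → ℝ} (hA : ∀ k, ContDiff ℝ ∞ (A k)) :
    ContDiff ℝ ∞ fun x => (jacobian A x).det := by
  simp only [Matrix.det_apply']
  exact ContDiff.sum fun σ _ => contDiff_const.mul
    (contDiff_prod fun i _ => contDiff_partialDeriv (hA _) _)

variable {n : ℕ}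

theorem nambuFlow_congr {H H' : Fin n → Space (n + 1) → ℝ} {x : Space (n + 1)}
    (h : ∀ a, H a =ᶠ[𝓝 x] H' a) (μ : Fin (n + 1)) : nambuFlow H x μ = nambuFlow H' x μ := by
  rw [nambuFlow, nambuFlow, nambuBracket, nambuBracket]
  refine Finset.sum_congr rfl fun σ _ => ?_
  congr 1
  refine Finset.prod_congr rfl fun k _ => ?_
  refine Fin.cases ?_ (fun a => ?_) k
  · rfl
  · simpa using partialDeriv_congr (h a) _

/-- The Nambu flow is a column of the adjugate of a Jacobian matrix. -/
theorem nambuFlow_eq_adjugate (A : Fin (n + 1) → Space (n + 1) → ℝ) (x : Space (n + 1))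
    (μ : Fin (n + 1)) :
    nambuFlow (fun a => A a.succ) x μ = (jacobian A x).adjugate μ 0 := by
  rw [nambuFlow, nambuBracket_eq_det, Matrix.adjugate_apply]
  congr 1
  ext k i
  refine Fin.cases ?_ (fun a => ?_) k
  · simp only [jacobian, Matrix.of_apply, Fin.cons_zero, Matrix.updateRow_self]
    exact partialDeriv_coord i μ x
  · simp [jacobian, Matrix.updateRow_ne]

/-- If `A 1, …, A n` are first integrals of `w` and `A 0` is a time function, then the Nambu flow of
the first integrals is `w` scaled by the Jacobian determinant: this is Cramer's rule. -/
theorem nambuFlow_eq_det_mul {A : Fin (n + 1) → Space (n + 1) → ℝ} {x w : Space (n + 1)}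
    (h0 : fderiv ℝ (A 0) x w = 1) (hs : ∀ a : Fin n, fderiv ℝ (A a.succ) x w = 0)
    (μ : Fin (n + 1)) :
    nambuFlow (fun a => A a.succ) x μ = (jacobian A x).det * w μ := by
  have h1 : (jacobian A x).mulVec (fun i => w i) = Pi.single 0 1 := by
    rw [jacobian_mulVec]
    ext k
    refine Fin.cases ?_ (fun a => ?_) k
    · simp [h0]
    · simp [hs]
  have h2 : (jacobian A x).adjugate.mulVec ((jacobian A x).mulVec fun i => w i)
      = (jacobian A x).det • fun i => w i := by
    rw [Matrix.mulVec_mulVec, Matrix.adjugate_mul, Matrix.smul_mulVec, Matrix.one_mulVec]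
  rw [h1, Matrix.mulVec_single_one] at h2
  rw [nambuFlow_eq_adjugate]
  exact congrFun h2 μ

theorem nambuFlow_eq_sum (H : Fin n → Space (n + 1) → ℝ) (x : Space (n + 1))
    (μ : Fin (n + 1)) :
    nambuFlow H x μ = ∑ σ : Equiv.Perm (Fin (n + 1)),
      ((Equiv.Perm.sign σ : ℤ) : ℝ) * (Pi.single μ 1 : Fin (n + 1) → ℝ) (σ 0) *
        ∏ a : Fin n, partialDeriv (σ a.succ) (H a) x := by
  rw [nambuFlow, nambuBracket]
  refine Finset.sum_congr rfl fun σ _ => ?_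
  rw [Fin.prod_univ_succ, Fin.cons_zero, partialDeriv_coord, mul_assoc]
  simp

/-- The Nambu flow is incompressible: each term of its divergence contains a second derivative
`∂_{σ 0} ∂_{σ (a + 1)} H_a`, and cancels against the term of `σ ∘ (0 a+1)`. -/
theorem sum_partialDeriv_nambuFlow {H : Fin n → Space (n + 1) → ℝ}
    (hH : ∀ a, ContDiff ℝ ∞ (H a)) (x : Space (n + 1)) :
    ∑ μ, partialDeriv μ (fun y => nambuFlow H y μ) x = 0 := by
  have hd : ∀ (a : Fin n) (i : Fin (n + 1)), HasFDerivAt (partialDeriv i (H a))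
      (fderiv ℝ (partialDeriv i (H a)) x) x := fun a i =>
    ((contDiff_partialDeriv (hH a) i).differentiable (by simp) x).hasFDerivAt
  have h1 : ∀ μ, partialDeriv μ (fun y => nambuFlow H y μ) x
      = ∑ σ : Equiv.Perm (Fin (n + 1)),
        ((Equiv.Perm.sign σ : ℤ) : ℝ) * (Pi.single μ 1 : Fin (n + 1) → ℝ) (σ 0) *
          ∑ a : Fin n, (∏ b ∈ Finset.univ.erase a, partialDeriv (σ b.succ) (H b) x) *
            partialDeriv μ (partialDeriv (σ a.succ) (H a)) x := by
    intro μ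
    have h2 := HasFDerivAt.fun_sum (u := Finset.univ) fun (σ : Equiv.Perm (Fin (n + 1))) _ =>
      (HasFDerivAt.finsetProd (u := Finset.univ) fun (a : Fin n) _ => hd a (σ a.succ)).const_mul
        (((Equiv.Perm.sign σ : ℤ) : ℝ) * (Pi.single μ 1 : Fin (n + 1) → ℝ) (σ 0))
    simp only [nambuFlow_eq_sum]
    rw [partialDeriv, h2.fderiv]
    simp [partialDeriv]
  simp only [h1]
  rw [Finset.sum_comm]
  have h3 : ∀ σ : Equiv.Perm (Fin (n + 1)), ∑ μ,
      ((Equiv.Perm.sign σ : ℤ) : ℝ) * (Pi.single μ 1 : Fin (n + 1) → ℝ) (σ 0) *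
          ∑ a : Fin n, (∏ b ∈ Finset.univ.erase a, partialDeriv (σ b.succ) (H b) x) *
            partialDeriv μ (partialDeriv (σ a.succ) (H a)) x
      = ∑ a : Fin n, ((Equiv.Perm.sign σ : ℤ) : ℝ) *
          ((∏ b ∈ Finset.univ.erase a, partialDeriv (σ b.succ) (H b) x) *
            partialDeriv (σ 0) (partialDeriv (σ a.succ) (H a)) x) := by
    intro σ
    rw [Finset.sum_eq_single (σ 0)]
    · rw [Pi.single_eq_same, mul_one, Finset.mul_sum]
    · intro μ _ hμ
      rw [Pi.single_eq_of_ne hμ.symm, mul_zero, zero_mul]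
    · simp
  simp only [h3]
  rw [Finset.sum_comm]
  refine Finset.sum_eq_zero fun a _ => ?_
  rw [← self_eq_neg, ← Finset.sum_neg_distrib]
  conv_lhs => rw [← Equiv.sum_comp (Equiv.mulRight (Equiv.swap 0 a.succ))]
  refine Finset.sum_congr rfl fun σ _ => ?_
  have hs : Equiv.Perm.sign (σ * Equiv.swap 0 a.succ) = -Equiv.Perm.sign σ := by
    rw [Equiv.Perm.sign_mul, Equiv.Perm.sign_swap (Fin.succ_ne_zero a).symm, mul_neg_one]
  have hp : ∏ b ∈ Finset.univ.erase a,
        partialDeriv ((σ * Equiv.swap 0 a.succ) b.succ) (H b) x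
      = ∏ b ∈ Finset.univ.erase a, partialDeriv (σ b.succ) (H b) x := by
    refine Finset.prod_congr rfl fun b hb => ?_
    rw [Equiv.Perm.mul_apply, Equiv.swap_apply_of_ne_of_ne (Fin.succ_ne_zero b)]
    exact fun h => (Finset.ne_of_mem_erase hb) (Fin.succ_injective _ h)
  simp only [Equiv.coe_mulRight, hs, hp]
  rw [Equiv.Perm.mul_apply, Equiv.Perm.mul_apply, Equiv.swap_apply_left, Equiv.swap_apply_right,
    partialDeriv_comm (hH a)]
  push_cast
  ring

/-! ### Incompressible fields are Nambu flows -/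

/-- A density `ρ` for which `ρ v` has the same vanishing divergence as `v` is a first integral. -/
theorem fderiv_eq_zero_of_divergence {N : ℕ} {v : Space N → Space N} (hv : ContDiff ℝ ∞ v)
    {ρ : Space N → ℝ} (hρ : ContDiff ℝ ∞ ρ) {x : Space N}
    (hdiv : ∑ μ, partialDeriv μ (fun y => v y μ) x = 0)
    (hdivρ : ∑ μ, partialDeriv μ (fun y => ρ y * v y μ) x = 0) :
    fderiv ℝ ρ x (v x) = 0 := by
  have h : ∀ μ, partialDeriv μ (fun y => ρ y * v y μ) x
      = ρ x * partialDeriv μ (fun y => v y μ) x + partialDeriv μ ρ x * v x μ := by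
    intro μ
    have h1 := (hρ.differentiable (by simp) x).hasFDerivAt.mul
      ((contDiff_apply_coord hv μ).differentiable (by simp) x).hasFDerivAt
    rw [partialDeriv, show (fun y => ρ y * v y μ) = ρ * fun y => v y μ from rfl, h1.fderiv]
    simp [partialDeriv]
    ring
  simp only [h] at hdivρ
  rw [Finset.sum_add_distrib, ← Finset.mul_sum, hdiv, mul_zero, zero_add] at hdivρ
  rw [fderiv_eq_sum_partialDeriv, hdivρ]

/-- A function whose derivative in the direction `e` vanishes near `0` does not depend, near `0`, on
the coordinate `ℓ` along `e`. -/
theorem eventually_eq_of_fderiv_eq_zero {E : Type*} [NormedAddCommGroup E] [NormedSpace ℝ E]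
    {f : E → ℝ} (hf : ContDiff ℝ ∞ f) (ℓ : E →L[ℝ] ℝ) (e : E)
    (h : ∀ᶠ y in 𝓝 (0 : E), fderiv ℝ f y e = 0) :
    ∀ᶠ y in 𝓝 (0 : E), f y = f (y - ℓ y • e) := by
  obtain ⟨r, hr, hrb⟩ := Metric.eventually_nhds_iff_ball.1 h
  have hc : Tendsto (fun y : E => y - ℓ y • e) (𝓝 0) (𝓝 0) := by
    have : Continuous fun y : E => y - ℓ y • e := by fun_prop
    simpa using this.tendsto 0
  filter_upwards [Metric.ball_mem_nhds (0 : E) hr, hc.eventually (Metric.ball_mem_nhds 0 hr)]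
    with y hy1 hy2
  let p : ℝ → E := fun s => (y - ℓ y • e) + s • (ℓ y • e)
  have hp : ∀ s, HasDerivAt p (ℓ y • e) s := fun s => by
    have h1 := ((hasDerivAt_id s).smul_const (ℓ y • e)).const_add (y - ℓ y • e)
    rwa [one_smul] at h1
  have hmem : ∀ s ∈ Icc (0 : ℝ) 1, p s ∈ Metric.ball (0 : E) r := by
    intro s hs
    have := (convex_ball (0 : E) r).add_smul_sub_mem hy2 hy1 hs
    rwa [sub_sub_cancel] at this
  have hd : ∀ s ∈ Icc (0 : ℝ) 1, HasDerivAt (fun s => f (p s)) 0 s := by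
    intro s hs
    have h1 := (hf.differentiable (by simp) (p s)).hasFDerivAt.comp_hasDerivAt s (hp s)
    rwa [map_smul, hrb _ (hmem s hs), smul_zero] at h1
  have h2 := constant_of_has_deriv_right_zero
    (fun s hs => (hd s hs).continuousAt.continuousWithinAt)
    (fun s hs => (hd s ⟨hs.1, hs.2.le⟩).hasDerivWithinAt) 1 (right_mem_Icc.2 zero_le_one)
  simpa [p] using h2

/-- Near a point where it does not vanish, an incompressible smooth field is a Nambu flow. In
straightening coordinates `g` the flow of `g 1, …, g n` is `ρ v` with `ρ` the Jacobian determinant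
of `g`. Both fields are incompressible, so `ρ` is a first integral and thus a function of
`g 1, …, g n`; replacing `g 1` by a primitive `h ∘ g` of `1 / ρ` with respect to that coordinate
normalises the density. -/
theorem exists_nambuFlow_of_ne_zero {m : ℕ} {v : Space (m + 2) → Space (m + 2)}
    (hv : ContDiff ℝ ∞ v) {x₀ : Space (m + 2)}
    (hdiv : ∀ᶠ x in 𝓝 x₀, ∑ μ, partialDeriv μ (fun y => v y μ) x = 0) (hv₀ : v x₀ ≠ 0) :
    ∃ H : Fin (m + 1) → Space (m + 2) → ℝ, (∀ a, ContDiff ℝ ∞ (H a)) ∧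
      ∀ᶠ x in 𝓝 x₀, ∀ μ, v x μ = nambuFlow H x μ := by
  let e : Fin (m + 2) → Space (m + 2) := fun i => EuclideanSpace.single i 1
  let ℓ : Fin (m + 2) → Space (m + 2) →L[ℝ] ℝ := fun i => EuclideanSpace.proj i
  have hℓe : ∀ i, ℓ i (e i) = 1 := fun i => by simp [ℓ, e]
  obtain ⟨Ψ, g, hΨ, hg, hΨ0, hg0, hgx, hΨe⟩ := hv.exists_straightening hv₀ (ℓ 0) (hℓe 0)
  let A : Fin (m + 2) → Space (m + 2) → ℝ := fun k x => g x k
  have hA : ∀ k, ContDiff ℝ ∞ (A k) := contDiff_apply_coord hg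
  let ρ : Space (m + 2) → ℝ := fun x => (jacobian A x).det
  have hρ : ContDiff ℝ ∞ ρ := contDiff_det_jacobian hA
  have hAv : ∀ᶠ x in 𝓝 x₀, ∀ k, fderiv ℝ (A k) x (v x) = e 0 k := by
    filter_upwards [hgx] with x hx k
    rw [fderiv_apply_coord hg, hx.2]
  have hflow : ∀ᶠ x in 𝓝 x₀, ∀ μ, nambuFlow (fun a => A a.succ) x μ = ρ x * v x μ := by
    filter_upwards [hAv] with x hx μ
    refine nambuFlow_eq_det_mul ?_ (fun a => ?_) μ
    · rw [hx]; simp [e]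
    · rw [hx]; simp [e]
  have hρv : ∀ᶠ x in 𝓝 x₀, fderiv ℝ ρ x (v x) = 0 := by
    filter_upwards [hdiv, hflow.eventually_nhds] with x hx1 hx2
    refine fderiv_eq_zero_of_divergence hv hρ hx1 ?_
    rw [← sum_partialDeriv_nambuFlow (fun a : Fin (m + 1) => hA a.succ) x]
    refine Finset.sum_congr rfl fun μ _ => partialDeriv_congr ?_ μ
    filter_upwards [hx2] with y hy
    exact (hy μ).symm
  -- `Ψ ∘ g = id` near `x₀`, so the derivative of `g` at `x₀` is injective
  have hρ0 : ρ x₀ ≠ 0 := by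
    intro h0
    obtain ⟨w, hw, hw0⟩ := Matrix.exists_mulVec_eq_zero_iff.2 h0
    let w' : Space (m + 2) := WithLp.toLp 2 w
    have h1 : fderiv ℝ g x₀ w' = 0 := by
      ext k
      rw [← fderiv_apply_coord hg]
      have := jacobian_mulVec A x₀ w'
      exact (congrFun this k).symm.trans (congrFun hw0 k)
    have h2 : HasFDerivAt (fun x => Ψ (g x)) ((fderiv ℝ Ψ (g x₀)).comp (fderiv ℝ g x₀)) x₀ :=
      (hΨ.differentiable (by simp) _).hasFDerivAt.comp x₀
        (hg.differentiable (by simp) _).hasFDerivAt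
    have h3 : HasFDerivAt (fun x => Ψ (g x)) (ContinuousLinearMap.id ℝ _) x₀ :=
      (hasFDerivAt_id x₀).congr_of_eventuallyEq (hgx.mono fun x hx => hx.1)
    have h4 := congrArg (fun L : Space (m + 2) →L[ℝ] Space (m + 2) => L w') (h2.unique h3)
    simp only [ContinuousLinearMap.comp_apply, h1, map_zero] at h4
    apply hw
    have h5 : w' = 0 := h4.symm
    ext k
    exact congrArg (fun u : Space (m + 2) => u k) h5
  -- the density in the straightening coordinates does not depend on the time coordinate
  have hρΨ : ContDiff ℝ ∞ fun y => ρ (Ψ y) := hρ.comp hΨ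
  have hΨt : Tendsto Ψ (𝓝 0) (𝓝 x₀) := hΨ0 ▸ hΨ.continuous.tendsto 0
  have hconst : ∀ᶠ y in 𝓝 (0 : Space (m + 2)), ρ (Ψ y) = ρ (Ψ (y - ℓ 0 y • e 0)) := by
    refine eventually_eq_of_fderiv_eq_zero hρΨ (ℓ 0) (e 0) ?_
    filter_upwards [hΨe, hΨt.eventually hρv] with y hy1 hy2
    have h1 : HasFDerivAt (fun y => ρ (Ψ y)) ((fderiv ℝ ρ (Ψ y)).comp (fderiv ℝ Ψ y)) y :=
      (hρ.differentiable (by simp) _).hasFDerivAt.comp y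
        (hΨ.differentiable (by simp) _).hasFDerivAt
    rw [h1.fderiv, ContinuousLinearMap.comp_apply, hy1, hy2]
  have hW : IsOpen {y | ρ (Ψ y) ≠ 0} := isOpen_ne_fun hρΨ.continuous continuous_const
  obtain ⟨q, hq, hqe⟩ := ContDiffOn.exists_contDiff_eventuallyEq (f := fun y => (ρ (Ψ y))⁻¹)
    (U := {y | ρ (Ψ y) ≠ 0}) (x₀ := 0) (fun y hy => (hρΨ.contDiffAt.inv hy).contDiffWithinAt)
    (hW.mem_nhds (by simpa [hΨ0] using hρ0))
  obtain ⟨h, hh, hhd⟩ := hq.exists_smooth_primitive (ℓ 1) (hℓe 1)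
  let P : Space (m + 2) →L[ℝ] Space (m + 2) :=
    ContinuousLinearMap.id ℝ _ - (ℓ 0).smulRight (e 0)
  have hP : ∀ y, P y = y - ℓ 0 y • e 0 := fun y => rfl
  have hPe0 : P (e 0) = 0 := by rw [hP, hℓe, one_smul, sub_self]
  have hPe1 : P (e 1) = e 1 := by
    rw [hP]; simp [ℓ, e]
  have hhP : ∀ y, HasFDerivAt (fun y => h (P y)) ((fderiv ℝ h (P y)).comp P) y := fun y =>
    (hh.differentiable (by simp) _).hasFDerivAt.comp y P.hasFDerivAt
  have hhe1 : ∀ y, fderiv ℝ h y (e 1) = q y := by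
    intro y
    have h1 : HasDerivAt (fun t : ℝ => y + t • e 1) (e 1) 0 := by
      simpa using ((hasDerivAt_id (0 : ℝ)).smul_const (e 1)).const_add y
    have h2 : HasFDerivAt h (fderiv ℝ h y) (y + (0 : ℝ) • e 1) := by
      rw [zero_smul, add_zero]
      exact (hh.differentiable (by simp) _).hasFDerivAt
    exact (h2.comp_hasDerivAt 0 h1).unique (hhd y)
  let k : Space (m + 2) → ℝ := fun x => h (P (g x))
  have hk : ContDiff ℝ ∞ k := hh.comp (P.contDiff.comp hg)
  have hkd : ∀ x w, fderiv ℝ k x w = fderiv ℝ h (P (g x)) (P (fderiv ℝ g x w)) := by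
    intro x w
    have h1 : HasFDerivAt k (((fderiv ℝ h (P (g x))).comp P).comp (fderiv ℝ g x)) x :=
      (hhP (g x)).comp x (hg.differentiable (by simp) _).hasFDerivAt
    rw [h1.fderiv]
    rfl
  -- `B` has the row `d(h ∘ P ∘ g) = ∑ i, ∂_i (h ∘ P) dg_i` in place of `dg_1`, so its determinant
  -- is `∂_1 h * ρ`
  let B : Fin (m + 2) → Space (m + 2) → ℝ := Function.update A 1 k
  have hB : ∀ i, ContDiff ℝ ∞ (B i) := by
    intro i
    by_cases hi : i = 1
    · subst hi; simpa [B] using hk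
    · simpa [B, Function.update_of_ne hi] using hA i
  have hdet : ∀ x, (jacobian B x).det = fderiv ℝ h (P (g x)) (P (e 1)) * ρ x := by
    intro x
    have h1 : jacobian B x = (jacobian A x).updateRow 1
        (∑ i, fderiv ℝ h (P (g x)) (P (e i)) • jacobian A x i) := by
      ext i j
      by_cases hi : i = 1
      · subst hi
        rw [Matrix.updateRow_self]
        simp only [jacobian, Matrix.of_apply, B, Function.update_self, Finset.sum_apply,
          Pi.smul_apply, smul_eq_mul]
        rw [partialDeriv, hkd]
        conv_lhs => rw [← sum_single (fderiv ℝ g x (EuclideanSpace.single j 1))]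
        rw [map_sum, map_sum]
        refine Finset.sum_congr rfl fun i _ => ?_
        rw [map_smul, map_smul, smul_eq_mul, mul_comm, partialDeriv, fderiv_apply_coord hg]
      · rw [Matrix.updateRow_ne hi]
        simp [jacobian, B, Function.update_of_ne hi]
    rw [h1, Matrix.det_updateRow_sum, smul_eq_mul]
  refine ⟨fun a => B a.succ, fun a => hB a.succ, ?_⟩
  have hgt : Tendsto g (𝓝 x₀) (𝓝 0) := hg0 ▸ hg.continuous.tendsto x₀
  have hPt : Tendsto P (𝓝 0) (𝓝 0) := by simpa using P.continuous.tendsto 0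
  have hρne : ∀ᶠ x in 𝓝 x₀, ρ x ≠ 0 := hρ.continuous.continuousAt.eventually_ne hρ0
  filter_upwards [hAv, hgx, hgt.eventually hconst, (hPt.comp hgt).eventually hqe, hρne]
    with x hx1 hx2 hx3 hx4 hx5 μ
  have hone : (jacobian B x).det = 1 := by
    have h1 : q (P (g x)) = (ρ (Ψ (P (g x))))⁻¹ := hx4
    rw [hdet, hPe1, hhe1, h1, hP, ← hx3, hx2.1, inv_mul_cancel₀ hx5]
  rw [nambuFlow_eq_det_mul (A := B) (w := v x) ?_ (fun a => ?_) μ, hone, one_mul]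
  · have : B 0 = A 0 := Function.update_of_ne (by simp) _ _
    rw [this, hx1]; simp [e]
  · by_cases ha : a.succ = 1
    · have : B a.succ = k := by rw [ha]; simp [B]
      rw [this, hkd, hx2.2, hPe0, map_zero]
    · have : B a.succ = A a.succ := Function.update_of_ne ha _ _
      rw [this, hx1]; simp [e]

/-! ### Curl-free fields are gradients -/

/-- The Poincaré lemma for vector fields. -/
theorem exists_partialDeriv_eq_of_curlFree {N : ℕ} {v : Space N → Space N}
    (hv : ContDiff ℝ ∞ v) {x₀ : Space N} (hcurl : ∀ᶠ x in 𝓝 x₀, ∀ μ ν : Fin N,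
      partialDeriv μ (fun y => v y ν) x = partialDeriv ν (fun y => v y μ) x) :
    ∃ S : Space N → ℝ, ContDiff ℝ ∞ S ∧ ∀ᶠ x in 𝓝 x₀, ∀ μ, v x μ = partialDeriv μ S x := by
  obtain ⟨r, hr, hrb⟩ := Metric.eventually_nhds_iff_ball.1 hcurl
  let θ : Space N → Space N →L[ℝ] ℝ := fun x => innerSL ℝ (v x)
  have hθ : ContDiff ℝ ∞ θ := (innerSL ℝ).contDiff.comp hv
  have hθd : ∀ x a b, fderiv ℝ θ x a b = inner ℝ (fderiv ℝ v x a) b := by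
    intro x a b
    have h1 : HasFDerivAt θ ((innerSL ℝ).comp (fderiv ℝ v x)) x :=
      (innerSL ℝ (E := Space N)).hasFDerivAt.comp x (hv.differentiable (by simp) x).hasFDerivAt
    rw [h1.fderiv]
    rfl
  have hsum : ∀ x a b, fderiv ℝ θ x a b
      = ∑ i, ∑ j, partialDeriv j (fun y => v y i) x * a j * b i := by
    intro x a b
    rw [hθd, PiLp.inner_apply]
    refine Finset.sum_congr rfl fun i _ => ?_
    rw [← fderiv_apply_coord hv, fderiv_eq_sum_partialDeriv, ← Finset.sum_mul]
    simp [mul_comm]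
  have hsymm : ∀ x ∈ Metric.ball x₀ r, ∀ a b, fderiv ℝ θ x a b = fderiv ℝ θ x b a := by
    intro x hx a b
    rw [hsum, hsum, Finset.sum_comm]
    refine Finset.sum_congr rfl fun i _ => Finset.sum_congr rfl fun j _ => ?_
    rw [hrb x hx i j]
    ring
  obtain ⟨S₀, hS₀⟩ := (convex_ball x₀ r).exists_forall_hasFDerivAt_of_fderiv_symmetric
    Metric.isOpen_ball (hθ.differentiable (by simp)).differentiableOn hsymm
  have hS₀s : ContDiffOn ℝ ∞ S₀ (Metric.ball x₀ r) := by
    rw [contDiffOn_infty_iff_fderiv_of_isOpen Metric.isOpen_ball]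
    refine ⟨fun x hx => (hS₀ x hx).differentiableAt.differentiableWithinAt, ?_⟩
    exact hθ.contDiffOn.congr fun x hx => (hS₀ x hx).fderiv
  obtain ⟨S, hS, hSe⟩ := hS₀s.exists_contDiff_eventuallyEq (Metric.ball_mem_nhds x₀ hr)
  refine ⟨S, hS, ?_⟩
  filter_upwards [hSe.eventually_nhds, Metric.ball_mem_nhds x₀ hr] with x hx1 hx2 μ
  rw [partialDeriv_congr hx1, partialDeriv, (hS₀ x hx2).fderiv]
  simp [θ, EuclideanSpace.inner_single_right]

/-- In the plane, an incompressible field is a Hamiltonian vector field, also near its zeros: the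
field rotated by a right angle is curl-free. -/
theorem exists_nambuFlow_plane {v : Space (1 + 1) → Space (1 + 1)} (hv : ContDiff ℝ ∞ v)
    {x₀ : Space (1 + 1)} (hdiv : ∀ᶠ x in 𝓝 x₀, ∑ μ, partialDeriv μ (fun y => v y μ) x = 0) :
    ∃ H : Fin 1 → Space (1 + 1) → ℝ, (∀ a, ContDiff ℝ ∞ (H a)) ∧
      ∀ᶠ x in 𝓝 x₀, ∀ μ, v x μ = nambuFlow H x μ := by
  let u : Space (1 + 1) → Space (1 + 1) := fun x => WithLp.toLp 2 ![-(v x 1), v x 0]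
  have hu : ContDiff ℝ ∞ u := by
    rw [contDiff_euclidean]
    intro i
    fin_cases i
    · exact (contDiff_apply_coord hv 1).neg
    · exact contDiff_apply_coord hv 0
  have hu0 : (fun x => u x 0) = fun x => -(v x 1) := rfl
  have hu1 : (fun x => u x 1) = fun x => v x 0 := rfl
  have hneg : ∀ x, partialDeriv 1 (fun y => -(v y 1)) x = -partialDeriv 1 (fun y => v y 1) x := by
    intro x
    rw [partialDeriv, fderiv_fun_neg]
    rfl
  obtain ⟨H, hH, hHe⟩ := exists_partialDeriv_eq_of_curlFree hu (x₀ := x₀) (by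
    filter_upwards [hdiv] with x hx
    rw [Fin.sum_univ_two] at hx
    have h10 : partialDeriv 1 (fun y => u y 0) x = partialDeriv 0 (fun y => u y 1) x := by
      rw [hu0, hu1, hneg]; linarith
    intro μ ν
    fin_cases μ <;> fin_cases ν
    · rfl
    · exact h10.symm
    · exact h10
    · rfl)
  refine ⟨fun _ => H, fun _ => hH, ?_⟩
  filter_upwards [hHe] with x hx μ
  have h0 : -(v x 1) = partialDeriv 0 H x := hx 0
  have h1 : v x 0 = partialDeriv 1 H x := hx 1
  rw [nambuFlow, nambuBracket_eq_det]
  have hdet : ∀ M : Matrix (Fin (1 + 1)) (Fin (1 + 1)) ℝ,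
      M.det = M 0 0 * M 1 1 - M 0 1 * M 1 0 := Matrix.det_fin_two
  rw [hdet]
  have e0 : ∀ i, jacobian (Fin.cons (fun y : Space (1 + 1) => y μ) fun _ => H) x 0 i
      = (Pi.single μ 1 : Fin (1 + 1) → ℝ) i := fun i => partialDeriv_coord i μ x
  have e1 : ∀ i, jacobian (Fin.cons (fun y : Space (1 + 1) => y μ) fun _ => H) x 1 i
      = partialDeriv i H x := fun i => rfl
  rw [e0, e0, e1, e1, ← h0, ← h1]
  fin_cases μ <;> simp

/-! ### Splitting off the divergence -/

/-- Two smooth fields with the same divergence become incompressible and non-vanishing by the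
subtraction of one and the same gradient: the Poisson equation removes the divergence, and a
linear function, which is harmonic, the zeros. -/
theorem exists_common_entropy {m : ℕ} {v w : Space (m + 2) → Space (m + 2)}
    (hv : ContDiff ℝ ∞ v) (hw : ContDiff ℝ ∞ w) {x₀ : Space (m + 2)}
    (hdiv : ∀ᶠ x in 𝓝 x₀, ∑ μ, partialDeriv μ (fun y => v y μ) x
      = ∑ μ, partialDeriv μ (fun y => w y μ) x) :
    ∃ S : Space (m + 2) → ℝ, ContDiff ℝ ∞ S ∧
      (∃ H : Fin (m + 1) → Space (m + 2) → ℝ, (∀ a, ContDiff ℝ ∞ (H a)) ∧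
        ∀ᶠ x in 𝓝 x₀, ∀ μ, v x μ = nambuFlow H x μ + partialDeriv μ S x) ∧
      ∃ H : Fin (m + 1) → Space (m + 2) → ℝ, (∀ a, ContDiff ℝ ∞ (H a)) ∧
        ∀ᶠ x in 𝓝 x₀, ∀ μ, w x μ = nambuFlow H x μ + partialDeriv μ S x := by
  have hdivs : ContDiff ℝ ∞ fun x => ∑ μ, partialDeriv μ (fun y => w y μ) x :=
    ContDiff.sum fun μ _ => contDiff_partialDeriv (contDiff_apply_coord hw μ) μ
  obtain ⟨S₀, hS₀, hlap⟩ :=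
    hdivs.exists_laplacian_eventuallyEq (EuclideanSpace.basisFun (Fin (m + 2)) ℝ) x₀
  let grad : Space (m + 2) → Space (m + 2) := fun x => WithLp.toLp 2 fun μ => partialDeriv μ S₀ x
  have hgrad : ContDiff ℝ ∞ grad :=
    contDiff_euclidean.2 fun μ => contDiff_partialDeriv hS₀ μ
  obtain ⟨a, ha⟩ := Infinite.exists_notMem_finset
    ({v x₀ - grad x₀, w x₀ - grad x₀} : Finset (Space (m + 2)))
  simp only [Finset.mem_insert, Finset.mem_singleton, not_or] at ha
  let S : Space (m + 2) → ℝ := fun x => S₀ x + innerSL ℝ a x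
  have hS : ContDiff ℝ ∞ S := hS₀.add (innerSL ℝ a).contDiff
  have hSd : ∀ x μ, partialDeriv μ S x = partialDeriv μ S₀ x + a μ := by
    intro x μ
    have h1 := (hS₀.differentiable (by simp) x).hasFDerivAt.add (innerSL ℝ a).hasFDerivAt
    rw [partialDeriv, show S = S₀ + innerSL ℝ a from rfl, h1.fderiv]
    simp [partialDeriv, EuclideanSpace.inner_single_right]
  -- the construction for a single field
  have key : ∀ u : Space (m + 2) → Space (m + 2), ContDiff ℝ ∞ u → a ≠ u x₀ - grad x₀ →
      (∀ᶠ x in 𝓝 x₀, ∑ μ, partialDeriv μ (fun y => u y μ) x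
        = ∑ μ, partialDeriv μ (fun y => w y μ) x) →
      ∃ H : Fin (m + 1) → Space (m + 2) → ℝ, (∀ a, ContDiff ℝ ∞ (H a)) ∧
        ∀ᶠ x in 𝓝 x₀, ∀ μ, u x μ = nambuFlow H x μ + partialDeriv μ S x := by
    intro u hu hau hdu
    let u' : Space (m + 2) → Space (m + 2) := fun x => u x - grad x - a
    have hu' : ContDiff ℝ ∞ u' := (hu.sub hgrad).sub contDiff_const
    have hu'0 : u' x₀ ≠ 0 := fun h => hau (sub_eq_zero.1 h).symm
    have hu'd : ∀ x μ, partialDeriv μ (fun y => u' y μ) x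
        = partialDeriv μ (fun y => u y μ) x - partialDeriv μ (partialDeriv μ S₀) x := by
      intro x μ
      have h1 := (((contDiff_apply_coord hu μ).differentiable (by simp) x).hasFDerivAt.sub
        ((contDiff_partialDeriv hS₀ μ).differentiable (by simp) x).hasFDerivAt).sub_const (a μ)
      exact congrArg (fun L : Space (m + 2) →L[ℝ] ℝ => L (EuclideanSpace.single μ 1)) h1.fderiv
    obtain ⟨H, hH, hHe⟩ := exists_nambuFlow_of_ne_zero hu' (x₀ := x₀) (by
      filter_upwards [hdu, hlap] with x hx1 hx2
      simp only [EuclideanSpace.basisFun_apply] at hx2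
      rw [Finset.sum_congr rfl fun μ _ => hu'd x μ, Finset.sum_sub_distrib, hx1, ← hx2]
      exact sub_self _) hu'0
    refine ⟨H, hH, ?_⟩
    filter_upwards [hHe] with x hx μ
    rw [← hx, hSd]
    change u x μ = u x μ - partialDeriv μ S₀ x - a μ + _
    ring
  exact ⟨S, hS, key v hv ha.1 hdiv, key w hw ha.2 (Eventually.of_forall fun _ => rfl)⟩

/-- Passage from identities near a point to a presentation on an open neighbourhood. -/
theorem exists_open_of_eventually {N : ℕ} {U : Set (Space N)} (hU : IsOpen U) {x₀ : Space N}
    (hx₀ : x₀ ∈ U) {p : Space N → Prop} (hp : ∀ᶠ x in 𝓝 x₀, p x) :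
    ∃ V : Set (Space N), IsOpen V ∧ x₀ ∈ V ∧ V ⊆ U ∧ ∀ x ∈ V, p x := by
  obtain ⟨W, hW, hWo, hxW⟩ := eventually_nhds_iff.1 hp
  exact ⟨U ∩ W, hU.inter hWo, ⟨hx₀, hxW⟩, inter_subset_left, fun x hx => hW x hx.2⟩

end NNET

theorem mainTheorem1 (n : ℕ) (hn : 1 ≤ n) (U : Set (NNET.Space (n + 1))) (hU : IsOpen U) :
    -- every smooth autonomous system is locally a NNET
    (∀ v : NNET.Space (n + 1) → NNET.Space (n + 1), ContDiffOn ℝ ∞ v U →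
      ∀ x₀ ∈ U, ∃ V : Set (NNET.Space (n + 1)), IsOpen V ∧ x₀ ∈ V ∧ V ⊆ U ∧
        ∃ (H : Fin n → NNET.Space (n + 1) → ℝ) (S : NNET.Space (n + 1) → ℝ),
          NNET.IsNNETOn V v H S) ∧
    -- a given splitting is realised term by term, away from the zeros of the incompressible
    -- part if the dimension is at least three
    (∀ v v₁ v₂ : NNET.Space (n + 1) → NNET.Space (n + 1),
      ContDiffOn ℝ ∞ v₁ U → ContDiffOn ℝ ∞ v₂ U →
      NNET.IsIncompressibleOn U v₁ → NNET.IsCurlFreeOn U v₂ →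
      (∀ x ∈ U, v x = v₁ x + v₂ x) →
      ∀ x₀ ∈ U, (n + 1 = 2 ∨ v₁ x₀ ≠ 0) →
        ∃ V : Set (NNET.Space (n + 1)), IsOpen V ∧ x₀ ∈ V ∧ V ⊆ U ∧
          ∃ (H : Fin n → NNET.Space (n + 1) → ℝ) (S : NNET.Space (n + 1) → ℝ),
            NNET.IsNNETOn V v H S ∧
            (∀ x ∈ V, ∀ μ, v₁ x μ = NNET.nambuFlow H x μ) ∧
            (∀ x ∈ V, ∀ μ, v₂ x μ = NNET.partialDeriv μ S x)) ∧
    -- reduction of a general non-linear response system to a simple NNET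
    (∀ (H : Fin n → NNET.Space (n + 1) → ℝ) (S : NNET.Space (n + 1) → ℝ)
      (L : (k : ℕ) → (Fin (k + 2) → Fin (n + 1)) → NNET.Space (n + 1) → ℝ)
      (v w : NNET.Space (n + 1) → NNET.Space (n + 1)),
      (∀ a, ContDiffOn ℝ ∞ (H a) U) → NNET.IsNonlinearResponseOn U L S w →
      (∀ x ∈ U, ∀ μ, v x μ = NNET.nambuFlow H x μ + w x μ) →
      ∀ x₀ ∈ U, ∃ V : Set (NNET.Space (n + 1)), IsOpen V ∧ x₀ ∈ V ∧ V ⊆ U ∧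
        ∃ (H' HC : Fin n → NNET.Space (n + 1) → ℝ) (SC : NNET.Space (n + 1) → ℝ),
          NNET.IsNNETOn V w H' SC ∧ NNET.IsNNETOn V v HC SC) := by
  obtain ⟨m, rfl⟩ : ∃ m, n = m + 1 := ⟨n - 1, by omega⟩
  refine ⟨?_, ?_, ?_⟩
  · intro v hv x₀ hx₀
    obtain ⟨v', hv', hve⟩ := hv.exists_contDiff_eventuallyEq (hU.mem_nhds hx₀)
    obtain ⟨S, hS, ⟨H, hH, hHe⟩, -⟩ := NNET.exists_common_entropy hv' hv' (x₀ := x₀)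
      (Eventually.of_forall fun _ => rfl)
    obtain ⟨V, hVo, hxV, hVU, hV⟩ := NNET.exists_open_of_eventually hU hx₀ (hHe.and hve)
    refine ⟨V, hVo, hxV, hVU, H, S, fun a => (hH a).contDiffOn, hS.contDiffOn, fun x hx μ => ?_⟩
    rw [← (hV x hx).2, (hV x hx).1 μ]
  · intro v v₁ v₂ hv₁ hv₂ hinc hcurl hsum x₀ hx₀ hcase
    obtain ⟨v₁', hv₁', hve₁⟩ := hv₁.exists_contDiff_eventuallyEq (hU.mem_nhds hx₀)
    obtain ⟨v₂', hv₂', hve₂⟩ := hv₂.exists_contDiff_eventuallyEq (hU.mem_nhds hx₀)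
    have hcoord : ∀ {f g : NNET.Space (m + 1 + 1) → NNET.Space (m + 1 + 1)}
        {x : NNET.Space (m + 1 + 1)}, f =ᶠ[𝓝 x] g → ∀ μ ν,
        NNET.partialDeriv μ (fun y => f y ν) x = NNET.partialDeriv μ (fun y => g y ν) x :=
      fun h μ ν => NNET.partialDeriv_congr (h.fun_comp fun u => u ν) μ
    have hdiv : ∀ᶠ x in 𝓝 x₀, ∑ μ, NNET.partialDeriv μ (fun y => v₁' y μ) x = 0 := by
      filter_upwards [hve₁.eventually_nhds, hU.mem_nhds hx₀] with x hx1 hx2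
      rw [← hinc x hx2]
      exact Finset.sum_congr rfl fun μ _ => hcoord hx1 μ μ
    have hcurl' : ∀ᶠ x in 𝓝 x₀, ∀ μ ν, NNET.partialDeriv μ (fun y => v₂' y ν) x
        = NNET.partialDeriv ν (fun y => v₂' y μ) x := by
      filter_upwards [hve₂.eventually_nhds, hU.mem_nhds hx₀] with x hx1 hx2 μ ν
      rw [hcoord hx1, hcoord hx1]
      exact sub_eq_zero.1 (hcurl x hx2 μ ν)
    obtain ⟨S, hS, hSe⟩ := NNET.exists_partialDeriv_eq_of_curlFree hv₂' hcurl'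
    obtain ⟨H, hH, hHe⟩ : ∃ H : Fin (m + 1) → NNET.Space (m + 1 + 1) → ℝ,
        (∀ a, ContDiff ℝ ∞ (H a)) ∧ ∀ᶠ x in 𝓝 x₀, ∀ μ, v₁' x μ = NNET.nambuFlow H x μ := by
      rcases hcase with h2 | hne
      · obtain rfl : m = 0 := by omega
        exact NNET.exists_nambuFlow_plane hv₁' hdiv
      · refine NNET.exists_nambuFlow_of_ne_zero hv₁' hdiv ?_
        rwa [hve₁.self_of_nhds]
    obtain ⟨V, hVo, hxV, hVU, hV⟩ := NNET.exists_open_of_eventually hU hx₀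
      ((hHe.and hve₁).and (hSe.and hve₂))
    have h1 : ∀ x ∈ V, ∀ μ, v₁ x μ = NNET.nambuFlow H x μ := fun x hx μ => by
      rw [← (hV x hx).1.2, (hV x hx).1.1 μ]
    have h2 : ∀ x ∈ V, ∀ μ, v₂ x μ = NNET.partialDeriv μ S x := fun x hx μ => by
      rw [← (hV x hx).2.2, (hV x hx).2.1 μ]
    refine ⟨V, hVo, hxV, hVU, H, S,
      ⟨fun a => (hH a).contDiffOn, hS.contDiffOn, fun x hx μ => ?_⟩, h1, h2⟩
    rw [← h1 x hx, ← h2 x hx, hsum x (hVU hx)]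
    rfl
  · intro H S L v w hH hresp hvw x₀ hx₀
    obtain ⟨w', hw', hwe⟩ := hresp.smooth_response.exists_contDiff_eventuallyEq (hU.mem_nhds hx₀)
    choose K hK hKe using fun a => (hH a).exists_contDiff_eventuallyEq (hU.mem_nhds hx₀)
    let flow : NNET.Space (m + 1 + 1) → NNET.Space (m + 1 + 1) :=
      fun x => WithLp.toLp 2 fun μ => NNET.nambuFlow K x μ
    have hflow : ContDiff ℝ ∞ flow := by
      refine contDiff_euclidean.2 fun μ => ?_
      simp only [flow, NNET.nambuFlow_eq_sum]
      exact ContDiff.sum fun σ _ => contDiff_const.mul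
        (contDiff_prod fun a _ => NNET.contDiff_partialDeriv (hK a) _)
    have hdiv : ∀ x, ∑ μ, NNET.partialDeriv μ (fun y => (flow y + w' y) μ) x
        = ∑ μ, NNET.partialDeriv μ (fun y => w' y μ) x := by
      intro x
      have h1 : ∀ μ, NNET.partialDeriv μ (fun y => (flow y + w' y) μ) x
          = NNET.partialDeriv μ (fun y => NNET.nambuFlow K y μ) x
            + NNET.partialDeriv μ (fun y => w' y μ) x := by
        intro μ
        have h2 := ((NNET.contDiff_apply_coord hflow μ).differentiable (by simp) x).hasFDerivAt.add
          ((NNET.contDiff_apply_coord hw' μ).differentiable (by simp) x).hasFDerivAt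
        exact congrArg (fun M : NNET.Space (m + 1 + 1) →L[ℝ] ℝ => M (EuclideanSpace.single μ 1))
          h2.fderiv
      rw [Finset.sum_congr rfl fun μ _ => h1 μ, Finset.sum_add_distrib,
        NNET.sum_partialDeriv_nambuFlow hK, zero_add]
    obtain ⟨SC, hSC, ⟨HC, hHC, hHCe⟩, ⟨H', hH', hHe'⟩⟩ :=
      NNET.exists_common_entropy (hflow.add hw') hw' (x₀ := x₀) (Eventually.of_forall hdiv)
    have hKflow : ∀ᶠ x in 𝓝 x₀, ∀ μ, NNET.nambuFlow K x μ = NNET.nambuFlow H x μ := by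
      filter_upwards [eventually_all.2 fun a => (hKe a).eventually_nhds] with x hx μ
      exact NNET.nambuFlow_congr hx μ
    obtain ⟨V, hVo, hxV, hVU, hV⟩ := NNET.exists_open_of_eventually hU hx₀
      ((hHCe.and hHe').and (hKflow.and hwe))
    refine ⟨V, hVo, hxV, hVU, H', HC, SC,
      ⟨fun a => (hH' a).contDiffOn, hSC.contDiffOn, fun x hx μ => ?_⟩,
      ⟨fun a => (hHC a).contDiffOn, hSC.contDiffOn, fun x hx μ => ?_⟩⟩
    · rw [← (hV x hx).2.2, (hV x hx).1.2 μ]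
    · rw [hvw x (hVU hx), ← (hV x hx).2.1, ← (hV x hx).2.2, ← (hV x hx).1.1 μ]
      rfl

end
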